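/- **Model.** A labelled graph is a finite simple undirected graph $G=(V,E)$ with $n=|V|$ vertices and maximum degree $\Delta$, in which the vertices carry distinct identifiers in $\mathbb{N}$ and the neighbours of every vertex $v$ are numbered by the ports $1,\dots,\deg(v)$ in an arbitrary fixed way. In the deterministic LOCAL model all vertices run the same deterministic algorithm. The local input of $v$ consists of its identifier, its degree (hence its set of ports), $\Delta$ and $n$. The computation proceeds in synchronous rounds; in each round every vertex receives, through each port, a message (of unbounded length) sent by the neighbour at that port, and updates its state by an arbitrary function of its local input, its current state and the messages received. The messages received in the first round are determined by the senders' local inputs, and those received in a later round by the senders' local inputs and their states after the preceding round. After the last round every vertex outputs, for each of its ports, one bit stating whether the edge at that port is selected. For $x\ge 1$ let $\log^*(x)=\min\{i\ge 0:\log_2^{(i)}(x)\le 1\}$, where $\log_2^{(i)}$ is the $i$-fold iterate of $\log_2$; put $\log^*(0)=0$. **Theorem.** For every polynomial $p$ with coefficients in $\mathbb{N}$ there is a constant $C>0$ such that for every $\varepsilon\in(0,1)$ there are a deterministic LOCAL algorithm $A$ and a function $r:\mathbb{N}^2\to\mathbb{N}$ with $$ r(n,\Delta)\;\le\;\Delta^{C/\varepsilon}+\frac{C}{\varepsilon^2}\cdot\log^*(n)\qquad\text{for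 all } n,\Delta\in\mathbb{N}, $$ such that on every labelled graph $G$ with $n$ vertices and maximum degree $\Delta$, all of whose identifiers are at most $p(n)$, the outputs of $A$ after $r(n,\Delta)$ rounds are consistent at the two endpoints of every edge, and the selected edges form a matching $M$ of $G$ with $|M|\ge(1-\varepsilon)\,|M^*|$, where $M^*$ is a maximum cardinality matching of $G$. -/

import Mathlib

noncomputable section

/-- The iterated-logarithm function: `logStar x` is the least `i` such that the `i`-fold
iterate of the base-2 logarithm, applied to `x`, is at most `1`. -/
def logStar (x : ℝ) : ℕ :=
  sInf {i : ℕ | (Real.logb 2)^[i] x ≤ 1}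

namespace LocalModel

/-- A labelling of a finite graph: distinct identifiers of the vertices, and for every
vertex `v` a numbering (by ports) of the neighbours of `v`. -/
structure Labeling {V : Type*} [Fintype V] (G : SimpleGraph V) [DecidableRel G.Adj] where
  /-- the identifier of a vertex -/
  id : V → ℕ
  /-- identifiers are distinct -/
  id_injective : Function.Injective id
  /-- `port v i` is the neighbour of `v` to which the port number `i` of `v` points -/
  port : ∀ v : V, Fin (G.degree v) ≃ G.neighborSet v

/-- What a processor knows initially. Its ports are the elements of `Fin degree`. -/
structure LocalInput where
  /-- the identifier of the vertex -/
  id : ℕ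
  /-- the degree of the vertex -/
  degree : ℕ
  /-- the maximum degree of the graph -/
  maxDegree : ℕ
  /-- the number of vertices of the graph -/
  numVertices : ℕ

/-- A deterministic synchronous message passing algorithm, executed by every processor.
States and messages range over arbitrary types: neither the length of the messages nor the
local computation is restricted. The local output is one bit for each port. -/
structure Algorithm where
  /-- the internal states of a processor -/
  State : Type
  /-- the messages -/
  Msg : Type
  /-- the state before the first round -/
  init : LocalInput → State
  /-- the message sent through each port, as a function of the current state -/
  send : (x : LocalInput) → State → Fin x.degree → Msg
  /-- the new state, computed from the old one and the messages received through the ports -/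
  step : (x : LocalInput) → State → (Fin x.degree → Msg) → State
  /-- the local output, computed from the final state -/
  output : (x : LocalInput) → State → Fin x.degree → Bool

section Execution

variable {V : Type*} [Fintype V] {G : SimpleGraph V} [DecidableRel G.Adj]

/-- The local input of the vertex `v`. -/
def Labeling.input (L : Labeling G) (v : V) : LocalInput where
  id := L.id v
  degree := G.degree v
  maxDegree := G.maxDegree
  numVertices := Fintype.card V

/-- If port `i` of `v` points to `u`, then this is the port of `u` that points to `v`. -/
def Labeling.reversePort (L : Labeling G) (v : V) (i : Fin (G.degree v)) :
    Fin (G.degree (L.port v i : V)) :=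
  (L.port (L.port v i : V)).symm ⟨v, G.adj_symm (L.port v i).2⟩

/-- The state of every processor after `t` synchronous rounds. In each round, `v` receives
through its port `i` the message that the neighbour `u` to which this port points has sent
through the port of `u` that points to `v`. -/
def Algorithm.stateAfter (A : Algorithm) (L : Labeling G) : ℕ → V → A.State
  | 0, v => A.init (L.input v)
  | t + 1, v =>
      A.step (L.input v) (A.stateAfter L t v) fun i : Fin (G.degree v) =>
        A.send (L.input (L.port v i)) (A.stateAfter L t (L.port v i)) (L.reversePort v i)

/-- The local output of `v` at its port `i` after `r` rounds. -/
def Algorithm.result (A : Algorithm) (L : Labeling G) (r : ℕ) (v : V)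
    (i : Fin (G.degree v)) : Bool :=
  A.output (L.input v) (A.stateAfter L r v) i

/-- After `r` rounds the local outputs encode the set of edges of the subgraph `M`: the
bit at a port of `v` tells whether the edge at this port belongs to `M`. -/
def Algorithm.ComputesIn (A : Algorithm) (L : Labeling G) (r : ℕ) (M : G.Subgraph) : Prop :=
  ∀ (v : V) (i : Fin (G.degree v)), A.result L r v i = true ↔ M.Adj v (L.port v i)

end Execution

end LocalModel

/-- `M` is a matching of `G` with at least `(1 - ε)` times as many edges as any matching
of `G`, equivalently, as a maximum one. -/
def IsApproxMaximumMatching {V : Type*} {G : SimpleGraph V} (ε : ℝ) (M : G.Subgraph) : Prop :=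
  M.IsMatching ∧
    ∀ M' : G.Subgraph, M'.IsMatching →
      (1 - ε) * (M'.edgeSet.ncard : ℝ) ≤ (M.edgeSet.ncard : ℝ)

end

/-! ### Matchings as involutions: improvements, components of two matchings, simultaneous
improvements. -/

section MateMaps

open scoped Classical

open Finset

/-! A matching is coded as an involution whose fixed points are the free vertices, and an
improvement is another matching with fewer fixed points. In the union of two matchings every
component is a path or a cycle, so the two matchings together have at most two free vertices in it.
A component with more free vertices for the first matching is an augmenting piece. If no improvement
changes fewer than `s` vertices, each such piece is long, and counting
(`StableBelow.mul_freeCount_le`) shows that the matching is within a factor `1 - O(1/s)` of the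
maximum. So it suffices to reach stability below `S = ⌈4/ε⌉`.

Stability is raised from `s` to `s + 1` by carrying out improvements of size exactly `s`. Such an
improvement lives on one component, hence within distance `s` of any vertex it changes
(`StableBelow.diffSet_subset_closedBall`). Vertices sharing a colour in a colouring that separates
vertices at distance at most `2s` can therefore act simultaneously without collision. As in the
analysis of Hopcroft and Karp, the counting bound shows that simultaneous smallest improvements
create no smaller ones (`IsMerge.stableBelow`), and that the improvements of size `s` that remain
were available before (`IsMerge.improvable`). Hence one pass through the colours exhausts size `s`.

The colouring comes from Linial's reduction by polynomials over a prime field: each step makes the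
bit length roughly logarithmic, so `logStar n` steps leave `Δ ^ O(S)` colours, up to a factor
depending on the bound for the identifiers (`exists_computableIn_colouring`). Locality is proved by
expressing each value as a function of the full view of a vertex. The point needing care is that the
improvements at a vertex, named by identifiers, depend only on data near it (`improvements_eq`). -/

/-- A matching of `G`, given as the involution that sends a vertex to its partner, and to
itself if the vertex is unmatched. -/
structure IsMateMap {V : Type*} (G : SimpleGraph V) (f : V → V) : Prop where
  invol : ∀ x, f (f x) = x
  adj : ∀ x, f x ≠ x → G.Adj x (f x)

/-- The vertices at which two maps differ. -/
noncomputable def diffSet {V : Type*} [Fintype V] (f g : V → V) : Finset V :=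
  univ.filter fun x => f x ≠ g x

/-- The number of fixed points. -/
noncomputable def freeCount {V : Type*} [Fintype V] (f : V → V) : ℕ :=
  #(univ.filter fun x => f x = x)

/-- The matching `g` has more edges than the matching `f`. -/
structure Improves {V : Type*} [Fintype V] (G : SimpleGraph V) (f g : V → V) : Prop where
  mate : IsMateMap G g
  lt : freeCount g < freeCount f

/-- Every improvement of `f` changes `f` at no fewer than `s` vertices. -/
def StableBelow {V : Type*} [Fintype V] (G : SimpleGraph V) (f : V → V) (s : ℕ) : Prop :=
  ∀ g, Improves G f g → s ≤ #(diffSet f g)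

/-- Some improvement of `f` changes `f` at exactly `s` vertices, including `u`. -/
def Improvable {V : Type*} [Fintype V] (G : SimpleGraph V) (f : V → V) (s : ℕ) (u : V) : Prop :=
  ∃ g, Improves G f g ∧ #(diffSet f g) = s ∧ u ∈ diffSet f g

/-- The vertices at distance at most `R`. -/
def closedBall {V : Type*} (G : SimpleGraph V) (v : V) (R : ℕ) : Set V :=
  {u | ∃ p : G.Walk v u, p.length ≤ R}

variable {V : Type*} {G : SimpleGraph V} {f g : V → V} {s : ℕ}

lemma IsMateMap.eq_comm (hf : IsMateMap G f) (x y : V) : f x = y ↔ f y = x :=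
  ⟨fun e => e ▸ hf.invol x, fun e => e ▸ hf.invol y⟩

/-- `g` on `D` and `f` elsewhere. -/
noncomputable def patch (D : Set V) (f g : V → V) (x : V) : V := if x ∈ D then g x else f x

lemma IsMateMap.patch (hf : IsMateMap G f) (hg : IsMateMap G g) {D : Set V}
    (hfD : ∀ x ∈ D, f x ∈ D) (hgD : ∀ x ∈ D, g x ∈ D) : IsMateMap G (patch D f g) := by
  constructor
  · intro x
    by_cases hx : x ∈ D
    · simp [_root_.patch, hx, hgD x hx, hg.invol]
    · have : f x ∉ D := fun h => hx (by simpa [hf.invol] using hfD _ h)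
      simp [_root_.patch, hx, this, hf.invol]
  · intro x
    by_cases hx : x ∈ D
    · simpa [_root_.patch, hx] using hg.adj x
    · simpa [_root_.patch, hx] using hf.adj x

/-- The pairs of distinct vertices matched by one of two matchings. -/
def mateGraph (f g : V → V) : SimpleGraph V :=
  SimpleGraph.fromRel fun x y => y = f x ∨ y = g x

lemma mateGraph_adj (hf : IsMateMap G f) (hg : IsMateMap G g) {x y : V} :
    (mateGraph f g).Adj x y ↔ x ≠ y ∧ (y = f x ∨ y = g x) := by
  rw [mateGraph, SimpleGraph.fromRel_adj]
  have h1 := hf.eq_comm x y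
  have h2 := hg.eq_comm x y
  grind

lemma mateGraph_le (hf : IsMateMap G f) (hg : IsMateMap G g) : mateGraph f g ≤ G := by
  intro x y hxy
  rw [mateGraph_adj hf hg] at hxy
  obtain ⟨hne, rfl | rfl⟩ := hxy
  · exact hf.adj x hne.symm
  · exact hg.adj x hne.symm

variable [Fintype V]

@[simp] lemma mem_diffSet {x : V} : x ∈ diffSet f g ↔ f x ≠ g x := by simp [diffSet]

lemma freeCount_eq_sum (f : V → V) : freeCount f = ∑ x, if f x = x then 1 else 0 := by
  simp [freeCount]

lemma IsMateMap.even_moved (hf : IsMateMap G f) :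
    2 ∣ #(univ.filter fun x => f x ≠ x) := by
  let σ : Equiv.Perm V := ⟨f, f, hf.invol, hf.invol⟩
  have h1 : σ ^ 2 = 1 := by ext x; simp [σ, pow_two, hf.invol]
  have h2 := Equiv.Perm.two_dvd_card_support h1
  have h3 : (univ.filter fun x => f x ≠ x) = σ.support := by
    ext x; simp [σ]
  rwa [h3]

lemma freeCount_add_moved (f : V → V) :
    freeCount f + #(univ.filter fun x => f x ≠ x) = Fintype.card V := by
  rw [freeCount, Finset.card_filter_add_card_filter_not, card_univ]

/-- Moved vertices come in pairs, so the numbers of free vertices have equal parity and a strict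
decrease is at least two. -/
lemma Improves.add_two_le (hf : IsMateMap G f) (hg : Improves G f g) :
    freeCount g + 2 ≤ freeCount f := by
  have h1 := hf.even_moved
  have h2 := hg.mate.even_moved
  have h3 := freeCount_add_moved f
  have h4 := freeCount_add_moved g
  have h5 := hg.lt
  omega

lemma mem_diffSet_of_left (hf : IsMateMap G f) (hg : IsMateMap G g) {x : V}
    (hx : x ∈ diffSet f g) : f x ∈ diffSet f g := by
  rw [mem_diffSet] at *
  rw [hf.invol]
  exact fun e => hx ((hg.eq_comm _ _).1 e.symm).symm

lemma diffSet_comm (f g : V → V) : diffSet f g = diffSet g f := by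
  ext; simp [ne_comm]

lemma mem_diffSet_of_right (hf : IsMateMap G f) (hg : IsMateMap G g) {x : V}
    (hx : x ∈ diffSet f g) : g x ∈ diffSet f g := by
  rw [diffSet_comm] at *
  exact mem_diffSet_of_left hg hf hx

lemma diffSet_subset_union (f g h : V → V) : diffSet f h ⊆ diffSet f g ∪ diffSet g h := by
  intro x
  simp only [mem_diffSet, mem_union]
  grind

/-- A connected graph on `N` vertices has at least `N - 1` edges, so its degrees already use up `2N
- 2` of the available total `2N`. -/
lemma sum_deficiency_le_two {W : Type*} [Fintype W] {H : SimpleGraph W}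
    (hH : H.Connected) (m : W → ℕ) (hm : ∀ x, H.degree x + m x ≤ 2) : ∑ x, m x ≤ 2 := by
  have h1 := hH.card_vert_le_card_edgeSet_add_one
  have h2 := H.sum_degrees_eq_twice_card_edges
  have h3 : ∑ x, (H.degree x + m x) ≤ ∑ _x : W, 2 := sum_le_sum fun x _ => hm x
  rw [sum_add_distrib, h2] at h3
  simp only [sum_const, card_univ, smul_eq_mul] at h3
  rw [Nat.card_eq_fintype_card, Nat.card_eq_fintype_card, ← SimpleGraph.edgeFinset_card] at h1
  omega

/-- A vertex has at most two neighbours in `mateGraph f g`, and each of the two maps fixing it costs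
one of them; `sum_deficiency_le_two` does the rest, without classifying paths and cycles. -/
lemma component_free_le_two (hf : IsMateMap G f) (hg : IsMateMap G g)
    (C : (mateGraph f g).ConnectedComponent) :
    #(univ.filter fun x => x ∈ C.supp ∧ f x = x) + #(univ.filter fun x => x ∈ C.supp ∧ g x = x)
      ≤ 2 := by
  have key := sum_deficiency_le_two (H := C.toSimpleGraph) C.connected_toSimpleGraph
    (fun x => (if f x = x then 1 else 0) + (if g x = x then 1 else 0)) (by
      intro x
      have h1 : C.toSimpleGraph.degree x ≤ #(({f x, g x} : Finset V).erase x) := by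
        rw [← SimpleGraph.card_neighborFinset_eq_degree]
        refine card_le_card_of_injOn (fun y => (y : V)) ?_ Subtype.val_injective.injOn
        intro y hy
        rw [mem_coe, SimpleGraph.mem_neighborFinset] at hy
        have := (mateGraph_adj hf hg).1 (show (mateGraph f g).Adj x y from hy)
        simp only [coe_erase, coe_insert, coe_singleton]
        grind
      refine le_trans (Nat.add_le_add_right h1 _) ?_
      by_cases h2 : f x = x <;> by_cases h3 : g x = x
      · simp [h2, h3]
      · rw [h2, erase_insert (by simpa using Ne.symm h3)]
        simp [h3]
      · rw [h3, pair_comm, erase_insert (by simpa using Ne.symm h2)]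
        simp [h2]
      · simp only [h2, h3, if_false, add_zero]
        exact (card_erase_le).trans card_le_two)
  rw [sum_add_distrib] at key
  have aux : ∀ k : V → V, #(univ.filter fun x => x ∈ C.supp ∧ k x = x) =
      ∑ x : C, if k x = x then 1 else 0 := by
    intro k
    rw [← card_filter]
    refine (card_bij (fun (x : C) _ => (x : V)) ?_ ?_ ?_).symm
    · intro x hx
      simp only [mem_filter, mem_univ, true_and] at hx ⊢
      exact ⟨x.2, hx⟩
    · intro x _ y _ e
      exact Subtype.ext e
    · intro x hx
      simp only [mem_filter, mem_univ, true_and] at hx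
      exact ⟨⟨x, hx.1⟩, by simpa using hx.2, rfl⟩
  rw [aux, aux]
  exact key

lemma card_filter_component (f g : V → V) (P : V → Prop) [DecidablePred P] :
    #(univ.filter P) = ∑ C : (mateGraph f g).ConnectedComponent,
      #(univ.filter fun x => x ∈ C.supp ∧ P x) := by
  rw [card_eq_sum_card_fiberwise (f := (mateGraph f g).connectedComponentMk) (t := univ)
    (by simp)]
  refine sum_congr rfl fun C _ => ?_
  congr 1
  ext x
  simp [SimpleGraph.ConnectedComponent.mem_supp_iff, and_comm]

/-- Both maps preserve a component of their union, so switching there alone gives a matching, and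
the free vertices outside cancel. -/
lemma patch_component_improves (hf : IsMateMap G f) (hg : IsMateMap G g)
    (C : (mateGraph f g).ConnectedComponent)
    (hlt : #(univ.filter fun x => x ∈ C.supp ∧ g x = x) <
      #(univ.filter fun x => x ∈ C.supp ∧ f x = x)) :
    Improves G f (patch C.supp f g) := by
  have closed : ∀ k : V → V, (∀ x, k x ≠ x → (mateGraph f g).Adj x (k x)) →
      ∀ x ∈ C.supp, k x ∈ C.supp := by
    intro k hk x hx
    by_cases e : k x = x
    · rwa [e]
    · exact C.mem_supp_of_adj_mem_supp hx (hk x e)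
  refine ⟨hf.patch hg (closed f fun x hx => ?_) (closed g fun x hx => ?_), ?_⟩
  · rw [mateGraph_adj hf hg]; exact ⟨hx.symm, Or.inl rfl⟩
  · rw [mateGraph_adj hf hg]; exact ⟨hx.symm, Or.inr rfl⟩
  · have split : ∀ k : V → V, freeCount k = #(univ.filter fun x => x ∈ C.supp ∧ k x = x) +
        #(univ.filter fun x => x ∉ C.supp ∧ k x = x) := by
      intro k
      rw [freeCount, ← card_filter_add_card_filter_not (fun x => x ∈ C.supp), filter_filter,
        filter_filter]
      simp only [and_comm]
    rw [split, split f]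
    have e1 : (univ.filter fun x => x ∈ C.supp ∧ patch C.supp f g x = x) =
        univ.filter fun x => x ∈ C.supp ∧ g x = x := by
      ext x; simp only [mem_filter, mem_univ, true_and, patch]; grind
    have e2 : (univ.filter fun x => x ∉ C.supp ∧ patch C.supp f g x = x) =
        univ.filter fun x => x ∉ C.supp ∧ f x = x := by
      ext x; simp only [mem_filter, mem_univ, true_and, patch]; grind
    rw [e1, e2]
    omega

lemma diffSet_patch (f g : V → V) (D : Set V) :
    diffSet f (patch D f g) = univ.filter fun x => x ∈ D ∧ f x ≠ g x := by
  ext x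
  simp only [mem_diffSet, patch, mem_filter, mem_univ, true_and]
  grind

/-- A matching without small improvements is nearly as large as any other matching. -/
lemma StableBelow.mul_freeCount_le (hs : StableBelow G f s) (hf : IsMateMap G f)
    (hg : IsMateMap G g) : s * freeCount f ≤ 2 * #(diffSet f g) + s * freeCount g := by
  have hd : #(diffSet f g) = ∑ C : (mateGraph f g).ConnectedComponent,
      #(univ.filter fun x => x ∈ C.supp ∧ f x ≠ g x) := by
    exact card_filter_component f g (fun x => f x ≠ g x)
  rw [hd, freeCount, freeCount, card_filter_component f g (fun x => f x = x),
    card_filter_component f g (fun x => g x = x), mul_sum, mul_sum, mul_sum, ← sum_add_distrib]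
  refine sum_le_sum fun C _ => ?_
  have h2 := component_free_le_two hf hg C
  -- Compare one component at a time: either `g` has at least as many free vertices there, or
  -- switching it is an improvement, so it contains at least `s` changes while `f` has at most two
  -- free vertices in it.
  rcases le_or_gt #(univ.filter fun x => x ∈ C.supp ∧ f x = x)
    #(univ.filter fun x => x ∈ C.supp ∧ g x = x) with hle | hlt
  · exact le_add_left (Nat.mul_le_mul_left s hle)
  · have h3 := hs _ (patch_component_improves hf hg C hlt)
    rw [diffSet_patch] at h3
    refine (Nat.mul_le_mul_left s (show _ ≤ 2 by omega)).trans (le_add_right ?_)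
    rw [mul_comm]
    refine Nat.mul_le_mul_left 2 (h3.trans_eq ?_)
    congr!

lemma exists_augmenting_component
    (hfg : freeCount g < freeCount f) : ∃ C : (mateGraph f g).ConnectedComponent,
      #(univ.filter fun x => x ∈ C.supp ∧ g x = x) <
        #(univ.filter fun x => x ∈ C.supp ∧ f x = x) := by
  rw [freeCount, freeCount, card_filter_component f g (fun x => f x = x),
    card_filter_component f g (fun x => g x = x)] at hfg
  obtain ⟨C, _, hC⟩ := exists_lt_of_sum_lt hfg
  exact ⟨C, hC⟩

/-- A smallest improvement changes the matching only near any vertex where it does. -/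
lemma StableBelow.diffSet_subset_closedBall (hs : StableBelow G f s) (hf : IsMateMap G f)
    (hg : Improves G f g) (hcard : #(diffSet f g) = s) {u x : V} (hu : u ∈ diffSet f g)
    (hx : x ∈ diffSet f g) : x ∈ closedBall G u s := by
  obtain ⟨C, hC⟩ := exists_augmenting_component hg.lt
  have h1 := hs _ (patch_component_improves hf hg.mate C hC)
  have hsub : diffSet f (patch C.supp f g) ⊆ diffSet f g := by
    rw [diffSet_patch]; intro y; simp
  -- Switching one augmenting component is already an improvement; by minimality of `s` it makes all
  -- the changes.
  have heq := eq_of_subset_of_card_le hsub (hcard.trans_le h1)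
  have hmem : ∀ y ∈ diffSet f g, y ∈ C.supp := by
    intro y hy
    rw [← heq, diffSet_patch] at hy
    simp only [mem_filter] at hy
    exact hy.2.1
  obtain ⟨p, hp⟩ := (C.reachable_of_mem_supp (hmem u hu) (hmem x hx)).exists_isPath
  -- The changed vertices are closed under both maps, so a path from `u` stays among them and has at
  -- most `s` vertices.
  have hin : ∀ {a b : V} (q : (mateGraph f g).Walk a b), a ∈ diffSet f g →
      ∀ y ∈ q.support, y ∈ diffSet f g := by
    intro a b q
    induction q with
    | nil => intro ha y hy; simp at hy; rwa [hy]
    | cons hadj q ih =>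
      intro ha y hy
      rw [SimpleGraph.Walk.support_cons, List.mem_cons] at hy
      obtain rfl | hy := hy
      · exact ha
      · refine ih ?_ y hy
        rw [mateGraph_adj hf hg.mate] at hadj
        obtain ⟨_, rfl | rfl⟩ := hadj
        · exact mem_diffSet_of_left hf hg.mate ha
        · exact mem_diffSet_of_right hf hg.mate ha
  have hlen : p.support.length ≤ s := by
    rw [← List.toFinset_card_of_nodup hp.support_nodup, ← hcard]
    refine card_le_card fun y hy => hin p hu y (by simpa using hy)
  rw [SimpleGraph.Walk.length_support] at hlen
  exact ⟨p.mapLe (mateGraph_le hf hg.mate), by simp; omega⟩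

/-- `F` results from `f` by carrying out the pairwise disjoint smallest improvements `k u`. -/
structure IsMerge (G : SimpleGraph V) (f : V → V) (s : ℕ) (S : Finset V) (k : V → V → V)
    (F : V → V) : Prop where
  improves : ∀ u ∈ S, Improves G f (k u)
  card_eq : ∀ u ∈ S, #(diffSet f (k u)) = s
  self_mem : ∀ u ∈ S, u ∈ diffSet f (k u)
  disjoint : ∀ u ∈ S, ∀ u' ∈ S, u ≠ u' → Disjoint (diffSet f (k u)) (diffSet f (k u'))
  eq_of_mem : ∀ u ∈ S, ∀ x ∈ diffSet f (k u), F x = k u x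
  eq_of_notMem : ∀ x, (∀ u ∈ S, x ∉ diffSet f (k u)) → F x = f x

namespace IsMerge

variable {S : Finset V} {k : V → V → V} {F : V → V}

lemma isMateMap (hF : IsMerge G f s S k F) (hf : IsMateMap G f) : IsMateMap G F := by
  have cases : ∀ x, (∃ u ∈ S, x ∈ diffSet f (k u)) ∨ ∀ u ∈ S, x ∉ diffSet f (k u) := by
    intro x; by_contra! h; obtain ⟨h1, u, hu, h2⟩ := h; exact h1 u hu h2
  constructor
  · intro x
    obtain ⟨u, hu, hx⟩ | hx := cases x
    · rw [hF.eq_of_mem u hu x hx,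
        hF.eq_of_mem u hu _ (mem_diffSet_of_right hf (hF.improves u hu).mate hx),
        (hF.improves u hu).mate.invol]
    · rw [hF.eq_of_notMem x hx, hF.eq_of_notMem, hf.invol]
      intro u hu h
      have := mem_diffSet_of_left hf (hF.improves u hu).mate h
      rw [hf.invol] at this
      exact hx u hu this
  · intro x
    obtain ⟨u, hu, hx⟩ | hx := cases x
    · rw [hF.eq_of_mem u hu x hx]
      exact (hF.improves u hu).mate.adj x
    · rw [hF.eq_of_notMem x hx]
      exact hf.adj x

lemma diffSet_eq (hF : IsMerge G f s S k F) :
    diffSet f F = S.biUnion fun u => diffSet f (k u) := by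
  ext x
  rw [mem_biUnion]
  constructor
  · intro hx
    by_contra! h
    exact (mem_diffSet.1 hx) (hF.eq_of_notMem x h).symm
  · rintro ⟨u, hu, hx⟩
    rw [mem_diffSet, hF.eq_of_mem u hu x hx]
    exact mem_diffSet.1 hx

lemma card_diffSet (hF : IsMerge G f s S k F) : #(diffSet f F) = #S * s := by
  rw [hF.diffSet_eq, card_biUnion (fun u hu u' hu' h => hF.disjoint u hu u' hu' h),
    sum_congr rfl hF.card_eq, sum_const, smul_eq_mul]

/-- The improvements act on disjoint sets, so their gains add up, and each gain is at least two. -/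
lemma freeCount_add_le (hF : IsMerge G f s S k F) (hf : IsMateMap G f) :
    freeCount F + 2 * #S ≤ freeCount f := by
  have key : ∑ u ∈ S, ((freeCount f : ℤ) - freeCount (k u)) = freeCount f - freeCount F := by
    simp only [freeCount_eq_sum, Nat.cast_sum, ← sum_sub_distrib]
    rw [sum_comm]
    refine sum_congr rfl fun x _ => ?_
    by_cases h : ∃ u ∈ S, x ∈ diffSet f (k u)
    · obtain ⟨u, hu, hx⟩ := h
      rw [sum_eq_single_of_mem u hu, hF.eq_of_mem u hu x hx]
      intro u' hu' hne
      have := disjoint_left.1 (hF.disjoint u hu u' hu' hne.symm) hx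
      rw [mem_diffSet, not_not] at this
      rw [this, sub_self]
    · push Not at h
      rw [hF.eq_of_notMem x h, sub_self]
      refine sum_eq_zero fun u hu => ?_
      have := h u hu
      rw [mem_diffSet, not_not] at this
      rw [this, sub_self]
  have h2 : ∑ _u ∈ S, (2 : ℤ) ≤ ∑ u ∈ S, ((freeCount f : ℤ) - freeCount (k u)) := by
    refine sum_le_sum fun u hu => ?_
    have := (hF.improves u hu).add_two_le hf
    omega
  rw [key, sum_const, nsmul_eq_mul] at h2
  omega

/-- The source of both minimality statements below: `F'` has at least `2 * (#S + 1)` fewer free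
vertices than `f`, so by `StableBelow.mul_freeCount_le` it differs from `f` at no fewer than `s *
(#S + 1)` vertices, all of them in the union. -/
lemma add_le_card_union (hF : IsMerge G f s S k F) (hf : IsMateMap G f)
    (hs : StableBelow G f s) {F' : V → V} (hF' : Improves G F F') :
    #S * s + s ≤ #(diffSet f F ∪ diffSet F F') := by
  have h1 := hs.mul_freeCount_le hf hF'.mate
  have h2 := hF'.add_two_le (hF.isMateMap hf)
  have h3 := hF.freeCount_add_le hf
  have h4 := card_le_card (diffSet_subset_union f F F')
  have h5 : s * (freeCount F' + 2 + 2 * #S) ≤ s * freeCount f :=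
    Nat.mul_le_mul_left s (by omega)
  nlinarith

/-- Carrying out smallest improvements creates no smaller ones. -/
lemma stableBelow (hF : IsMerge G f s S k F) (hf : IsMateMap G f)
    (hs : StableBelow G f s) : StableBelow G F s := by
  intro F' hF'
  have h1 := hF.add_le_card_union hf hs hF'
  have h2 := card_union_le (diffSet f F) (diffSet F F')
  have h3 := hF.card_diffSet
  omega

/-- The lower bound for the union equals the sum of the two cardinalities, which leaves no room for
overlap. -/
lemma disjoint_diffSet (hF : IsMerge G f s S k F) (hf : IsMateMap G f)
    (hs : StableBelow G f s) {F' : V → V} (hF' : Improves G F F') (hc : #(diffSet F F') = s) :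
    Disjoint (diffSet f F) (diffSet F F') := by
  have h1 := hF.add_le_card_union hf hs hF'
  have h3 := hF.card_diffSet
  rw [← card_union_eq_card_add_card]
  refine le_antisymm (card_union_le _ _) ?_
  omega

lemma not_improvable (hF : IsMerge G f s S k F) (hf : IsMateMap G f)
    (hs : StableBelow G f s) {u : V} (hu : u ∈ S) : ¬ Improvable G F s u := by
  rintro ⟨F', hF', hc, hmem⟩
  refine disjoint_left.1 (hF.disjoint_diffSet hf hs hF' hc) ?_ hmem
  rw [hF.diffSet_eq, mem_biUnion]
  exact ⟨u, hu, hF.self_mem u hu⟩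

/-- Carrying out smallest improvements creates no others of the same size. -/
lemma improvable (hF : IsMerge G f s S k F) (hf : IsMateMap G f)
    (hs : StableBelow G f s) {u : V} (hu : Improvable G F s u) : Improvable G f s u := by
  obtain ⟨F', hF', hc, hmem⟩ := hu
  have hd := hF.disjoint_diffSet hf hs hF' hc
  have hagree : ∀ x ∈ diffSet F F', f x = F x := by
    intro x hx
    have := disjoint_right.1 hd hx
    rwa [mem_diffSet, not_not] at this
  have hFm := hF.isMateMap hf
  -- By disjointness `f` and `F` agree where `F'` changes `F`, so the same changes can be applied to
  -- `f` directly, with the same gain.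
  have hds : diffSet f (patch (diffSet F F' : Set V) f F') = diffSet F F' := by
    rw [diffSet_patch]
    ext x
    simp only [mem_filter, mem_univ, true_and, mem_coe]
    refine ⟨fun h => h.1, fun h => ⟨h, ?_⟩⟩
    rw [hagree x h]
    exact mem_diffSet.1 h
  refine ⟨patch (diffSet F F' : Set V) f F', ⟨hf.patch hF'.mate ?_ ?_, ?_⟩, ?_, ?_⟩
  · intro x hx
    rw [hagree x hx]
    exact mem_diffSet_of_left hFm hF'.mate hx
  · intro x hx
    exact mem_diffSet_of_right hFm hF'.mate hx
  · have : freeCount (patch (diffSet F F' : Set V) f F') + freeCount F =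
        freeCount f + freeCount F' := by
      simp only [freeCount_eq_sum, ← sum_add_distrib]
      refine sum_congr rfl fun x _ => ?_
      by_cases hx : x ∈ diffSet F F'
      · simp only [patch, mem_coe, hx, if_true]
        rw [hagree x hx, add_comm]
      · have e : F x = F' x := by rwa [mem_diffSet, not_not] at hx
        simp only [patch, mem_coe, hx, if_false, e]
    have := hF'.lt
    omega
  · rw [hds, hc]
  · rwa [hds]

end IsMerge

end MateMaps

/-! ### From involutions to matchings as subgraphs, and the approximation ratio. -/

section MatchingSubgraphs

open scoped Classical

open Finset

variable {V : Type*} {G : SimpleGraph V} {f g : V → V} {s : ℕ}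

/-- The subgraph formed by the edges of a matching given as an involution. -/
def IsMateMap.toSubgraph (hf : IsMateMap G f) : G.Subgraph where
  verts := {x | f x ≠ x}
  Adj x y := f x = y ∧ x ≠ y
  adj_sub := by
    rintro x y ⟨rfl, h⟩
    exact hf.adj x h.symm
  edge_vert := by
    rintro x y ⟨rfl, h⟩
    exact h.symm
  symm := ⟨fun x y h => ⟨(hf.eq_comm x y).1 h.1, h.2.symm⟩⟩

lemma IsMateMap.toSubgraph_isMatching (hf : IsMateMap G f) : hf.toSubgraph.IsMatching := by
  intro x hx
  exact ⟨f x, ⟨rfl, fun h => hx h.symm⟩, fun y hy => hy.1.symm⟩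

/-- The involution that sends every vertex of a matching to its partner. -/
noncomputable def partner (M : G.Subgraph) (x : V) : V :=
  if h : ∃ y, M.Adj x y then h.choose else x

lemma partner_eq {M : G.Subgraph} (hM : M.IsMatching) {x y : V} (h : M.Adj x y) :
    partner M x = y := by
  have h' : ∃ y, M.Adj x y := ⟨y, h⟩
  rw [partner, dif_pos h']
  exact (hM (M.edge_vert h)).unique h'.choose_spec h

lemma isMateMap_partner {M : G.Subgraph} (hM : M.IsMatching) : IsMateMap G (partner M) := by
  constructor
  · intro x
    by_cases h : ∃ y, M.Adj x y
    · obtain ⟨y, h⟩ := h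
      rw [partner_eq hM h, partner_eq hM h.symm]
    · have : partner M x = x := dif_neg h
      rw [this, this]
  · intro x hx
    by_cases h : ∃ y, M.Adj x y
    · obtain ⟨y, h⟩ := h
      rw [partner_eq hM h]
      exact h.adj_sub
    · exact absurd (dif_neg h) hx

lemma partner_ne_iff {M : G.Subgraph} (hM : M.IsMatching) {x : V} :
    partner M x ≠ x ↔ x ∈ M.verts := by
  constructor
  · intro hx
    by_contra h
    exact hx (dif_neg fun ⟨y, hy⟩ => h (M.edge_vert hy))
  · intro hx
    obtain ⟨y, hy, -⟩ := hM hx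
    rw [partner_eq hM hy]
    exact hy.adj_sub.ne'

variable [Fintype V]

lemma two_mul_ncard_edgeSet {M : G.Subgraph} (hM : M.IsMatching) :
    2 * M.edgeSet.ncard = #(univ.filter fun x => x ∈ M.verts) := by
  have h1 := M.spanningCoe.sum_degrees_eq_twice_card_edges
  have h2 : #M.spanningCoe.edgeFinset = M.edgeSet.ncard := by
    rw [← SimpleGraph.Subgraph.edgeSet_spanningCoe, Set.ncard_eq_toFinset_card',
      SimpleGraph.edgeFinset]
  rw [← h2, ← h1, card_filter]
  refine sum_congr rfl fun x _ => ?_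
  rw [← SimpleGraph.card_neighborFinset_eq_degree]
  split_ifs with hx
  · obtain ⟨y, hy, hy'⟩ := hM hx
    rw [card_eq_one]
    refine ⟨y, ?_⟩
    ext z
    simp only [SimpleGraph.mem_neighborFinset, SimpleGraph.Subgraph.spanningCoe_adj,
      mem_singleton]
    exact ⟨hy' z, fun h => h ▸ hy⟩
  · rw [card_eq_zero]
    ext z
    simp only [SimpleGraph.mem_neighborFinset, SimpleGraph.Subgraph.spanningCoe_adj, notMem_empty,
      iff_false]
    exact fun h => hx (M.edge_vert h)

/-- With `a` and `b` edges, the counting bound becomes `(s - 2) * b ≤ (s + 2) * a`, and `s - 2 ≥ (1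
- ε) * (s + 2)` amounts to `ε * (s + 2) ≥ 4`. -/
lemma IsMateMap.isApproxMaximumMatching (hf : IsMateMap G f) (hs : StableBelow G f s) {ε : ℝ}
    (hε : 4 ≤ ε * s) (hε0 : 0 < ε) : IsApproxMaximumMatching ε hf.toSubgraph := by
  refine ⟨hf.toSubgraph_isMatching, fun M' hM' => ?_⟩
  have h1 := two_mul_ncard_edgeSet hf.toSubgraph_isMatching
  have h2 := two_mul_ncard_edgeSet hM'
  have h3 := hs.mul_freeCount_le hf (isMateMap_partner hM')
  have h4 : #(diffSet f (partner M')) ≤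
      2 * hf.toSubgraph.edgeSet.ncard + 2 * M'.edgeSet.ncard := by
    rw [h1, h2]
    refine (card_le_card ?_).trans (card_union_le _ _)
    intro x
    simp only [mem_diffSet, mem_union, mem_filter, mem_univ, true_and, ← partner_ne_iff hM']
    intro hx
    by_contra! h
    exact hx ((not_not.1 h.1).trans h.2.symm)
  have h5 : freeCount f + 2 * hf.toSubgraph.edgeSet.ncard = Fintype.card V := by
    have h : ∀ x, x ∈ hf.toSubgraph.verts ↔ f x ≠ x := fun _ => Iff.rfl
    rw [h1, ← freeCount_add_moved f]
    simp only [h]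
  have h6 : freeCount (partner M') + 2 * M'.edgeSet.ncard = Fintype.card V := by
    rw [h2, ← freeCount_add_moved (partner M')]
    simp only [partner_ne_iff hM']
  generalize hf.toSubgraph.edgeSet.ncard = a at *
  generalize M'.edgeSet.ncard = b at *
  generalize freeCount f = c at *
  generalize freeCount (partner M') = d at *
  have h7 : (c : ℝ) + 2 * a = d + 2 * b := by exact_mod_cast h5.trans h6.symm
  have h8 : (s : ℝ) * c ≤ 2 * (2 * a + 2 * b) + s * d := by
    exact_mod_cast h3.trans (by omega)
  have h9 : (s : ℝ) * (2 * b - 2 * a) ≤ 4 * a + 4 * b := by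
    have : (c : ℝ) = d + 2 * b - 2 * a := by linarith
    rw [this] at h8
    linarith
  have hs0 : (0 : ℝ) < s + 2 := by positivity
  have ha : (0 : ℝ) ≤ a := by positivity
  have hb : (0 : ℝ) ≤ b := by positivity
  have h10 : (s + 2 : ℝ) * ((1 - ε) * b) ≤ (s + 2) * a := by
    have : 4 * (b : ℝ) ≤ (ε * s) * b := mul_le_mul_of_nonneg_right hε hb
    nlinarith [mul_nonneg hε0.le hb]
  exact le_of_mul_le_mul_left h10 hs0

/-- Degrees at most one are treated apart, since `Δ ^ (C / ε)` does not grow with `C` there: all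
edges together form the maximum matching. -/
lemma isApproxMaximumMatching_of_maxDegree_le_one [DecidableRel G.Adj] (hG : G.maxDegree ≤ 1)
    {ε : ℝ} (hε : 0 < ε) :
    ∃ M : G.Subgraph, (∀ x y, M.Adj x y ↔ G.Adj x y) ∧ IsApproxMaximumMatching ε M := by
  let M : G.Subgraph :=
    { verts := {x | ∃ y, G.Adj x y}
      Adj := G.Adj
      adj_sub := id
      edge_vert := fun h => ⟨_, h⟩
      symm := G.symm }
  refine ⟨M, fun _ _ => Iff.rfl, ?_, fun M' _ => ?_⟩
  · rintro x ⟨y, hy⟩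
    refine ⟨y, hy, fun z hz => ?_⟩
    have h1 := (G.degree_le_maxDegree x).trans hG
    rw [← SimpleGraph.card_neighborFinset_eq_degree, card_le_one] at h1
    exact h1 z (by simpa using hz) y (by simpa using hy)
  · have h1 : M'.edgeSet.ncard ≤ M.edgeSet.ncard := by
      refine Set.ncard_le_ncard (fun e he => ?_) (Set.toFinite _)
      induction e with
      | _ x y => exact M'.adj_sub he
    have h2 : (M'.edgeSet.ncard : ℝ) ≤ M.edgeSet.ncard := by exact_mod_cast h1
    nlinarith [Nat.cast_nonneg (α := ℝ) M'.edgeSet.ncard]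

end MatchingSubgraphs

/-! ### Linial's colour reduction and the iterated logarithm. -/

section ColourReduction

open scoped Classical

open Finset Polynomial

/-- The polynomial of degree less than `k` whose coefficients are the last `k` bits of `x`. -/
noncomputable def bitPolynomial (q k x : ℕ) : (ZMod q)[X] :=
  ∑ i ∈ range k, C (if x.testBit i then 1 else 0) * X ^ i

lemma degree_bitPolynomial_lt (q k x : ℕ) : (bitPolynomial q k x).degree < k := by
  refine (degree_sum_le _ _).trans_lt ?_
  refine (Finset.sup_lt_iff (WithBot.bot_lt_coe k)).2 fun i hi => ?_
  refine (degree_C_mul_X_pow_le _ _).trans_lt ?_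
  exact WithBot.coe_lt_coe.2 (mem_range.1 hi)

lemma coeff_bitPolynomial (q : ℕ) {k i : ℕ} (x : ℕ) (hi : i < k) :
    (bitPolynomial q k x).coeff i = if x.testBit i then 1 else 0 := by
  rw [bitPolynomial, finsetSum_coeff]
  simp only [coeff_C_mul, coeff_X_pow]
  simp [hi]

lemma bitPolynomial_injOn {q k x y : ℕ} [Fact q.Prime] (hx : x < 2 ^ k) (hy : y < 2 ^ k)
    (h : bitPolynomial q k x = bitPolynomial q k y) : x = y := by
  refine Nat.eq_of_testBit_eq fun i => ?_
  by_cases hi : i < k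
  · have h1 := congrArg (fun p => p.coeff i) h
    simp only [coeff_bitPolynomial q _ hi] at h1
    cases hx : x.testBit i <;> cases hy : y.testBit i <;> simp [hx, hy] at h1 ⊢
  · have h2 : 2 ^ k ≤ 2 ^ i := Nat.pow_le_pow_right two_pos (not_lt.1 hi)
    rw [Nat.testBit_lt_two_pow (hx.trans_le h2), Nat.testBit_lt_two_pow (hy.trans_le h2)]

/-- A point at which the polynomial of `x` differs from those of all colours in `T`. -/
lemma exists_separating_point {q k d x : ℕ} [Fact q.Prime] {T : Finset ℕ} (hx : x < 2 ^ k)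
    (hT : ∀ y ∈ T, y < 2 ^ k) (hd : #T ≤ d) (hq : d * k < q) :
    ∃ a : ZMod q, ∀ y ∈ T, y ≠ x →
      (bitPolynomial q k y).eval a ≠ (bitPolynomial q k x).eval a := by
  -- Distinct polynomials of degree below `k` agree at no more than `k` points, so the at most `d`
  -- competitors spoil at most `d * k < q` points.
  by_contra! hcon
  let B : ℕ → Finset (ZMod q) := fun y =>
    univ.filter fun a => (bitPolynomial q k y).eval a = (bitPolynomial q k x).eval a
  have hB : ∀ y ∈ T.erase x, #(B y) ≤ k := by
    intro y hy
    rw [mem_erase] at hy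
    by_contra! hlt
    refine hy.1 (bitPolynomial_injOn (hT y hy.2) hx (eq_of_degree_sub_lt_of_eval_finset_eq (B y)
      ?_ fun a ha => ?_))
    · refine (degree_sub_le _ _).trans_lt ?_
      rw [max_lt_iff]
      have : (k : WithBot ℕ) ≤ #(B y) := by exact_mod_cast hlt.le
      exact ⟨(degree_bitPolynomial_lt q k y).trans_le this,
        (degree_bitPolynomial_lt q k x).trans_le this⟩
    · simpa [B] using ha
  have h1 : (univ : Finset (ZMod q)) ⊆ (T.erase x).biUnion B := by
    intro a _
    obtain ⟨y, hy, hne, he⟩ := hcon a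
    rw [mem_biUnion]
    exact ⟨y, mem_erase.2 ⟨hne, hy⟩, by simpa [B] using he⟩
  have h2 := (card_le_card h1).trans (card_biUnion_le_card_mul _ _ k hB)
  rw [card_univ, ZMod.card] at h2
  have h3 : #(T.erase x) * k ≤ d * k := Nat.mul_le_mul_right k ((card_erase_le).trans hd)
  omega

/-- The new colour of a vertex, computed from its colour `x` and the set `S` of the colours
in its neighbourhood. -/
noncomputable def reducedColour (q k x : ℕ) (S : Set ℕ) : ℕ :=
  if h : ∃ a : ZMod q, ∀ y ∈ S, y ≠ x →
      (bitPolynomial q k y).eval a ≠ (bitPolynomial q k x).eval a then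
    h.choose.val * q + ((bitPolynomial q k x).eval h.choose).val
  else 0

lemma reducedColour_lt {q k x : ℕ} [hq : Fact q.Prime] {S : Set ℕ} :
    reducedColour q k x S < q * q := by
  have hq0 := hq.out.pos
  unfold reducedColour
  split_ifs with h
  · have h1 := ZMod.val_lt h.choose
    have h2 := ZMod.val_lt ((bitPolynomial q k x).eval h.choose)
    nlinarith
  · positivity

/-- A new colour encodes a point and the value of the old colour's polynomial there. Equal new
colours would give the same point and the same value, but the point chosen for `x` separates it from
`y`. -/
lemma reducedColour_ne {q k d x y : ℕ} [hq : Fact q.Prime] {S T : Finset ℕ} (hx : x < 2 ^ k)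
    (hy : y < 2 ^ k) (hS : ∀ z ∈ S, z < 2 ^ k) (hT : ∀ z ∈ T, z < 2 ^ k)
    (hSd : #S ≤ d) (hTd : #T ≤ d) (hqd : d * k < q) (hyS : y ∈ S) (hxy : y ≠ x) :
    reducedColour q k x S ≠ reducedColour q k y T := by
  have h1 := exists_separating_point hx hS hSd hqd
  have h2 := exists_separating_point hy hT hTd hqd
  simp only [← mem_coe] at h1 h2
  rw [reducedColour, reducedColour, dif_pos h1, dif_pos h2]
  intro h
  have hs := h1.choose_spec y hyS hxy
  generalize h1.choose = a at *
  generalize h2.choose = b at *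
  have l1 := ZMod.val_lt ((bitPolynomial q k x).eval a)
  have l2 := ZMod.val_lt ((bitPolynomial q k y).eval b)
  have e1 := congrArg (· / q) h
  have e2 := congrArg (· % q) h
  have hq0 := hq.out.pos
  simp only [mul_comm _ q, Nat.mul_add_div hq0, Nat.div_eq_of_lt l1, Nat.div_eq_of_lt l2,
    Nat.mul_add_mod, Nat.mod_eq_of_lt l1, Nat.mod_eq_of_lt l2, add_zero] at e1 e2
  have e3 := ZMod.val_injective q e1
  subst e3
  exact hs (ZMod.val_injective q e2).symm

/-- The bit lengths of the colours in repeated colour reduction. -/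
def bitLength (b k : ℕ) : ℕ → ℕ
  | 0 => k
  | t + 1 => b + 2 * Nat.clog 2 (bitLength b k t)

lemma bitLength_succ' (b k t : ℕ) :
    bitLength b k (t + 1) = bitLength b (b + 2 * Nat.clog 2 k) t := by
  induction t with
  | zero => rfl
  | succ t ih => rw [bitLength, ih, bitLength]

lemma bitLength_pos {b k : ℕ} (hb : 0 < b) (hk : 0 < k) (t : ℕ) : 0 < bitLength b k t := by
  cases t with
  | zero => exact hk
  | succ t => rw [bitLength]; omega

lemma one_add_two_mul_sq_le (b : ℕ) : (1 + 2 * b) ^ 2 ≤ 2 ^ (b + 4) := by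
  induction b with
  | zero => norm_num
  | succ b ih =>
    rw [show b + 1 + 4 = b + 4 + 1 by ring, pow_succ 2]
    have h2 : 16 ≤ 2 ^ (b + 4) := by
      rw [pow_add]
      have := Nat.one_le_two_pow (n := b)
      omega
    rcases b with _ | _ | b
    · norm_num
    · norm_num
    · generalize 2 ^ (b + 1 + 1 + 4) = w at *
      nlinarith [Nat.zero_le (b * b)]

/-- The invariant for the bit length is `2 ^ α * z + 2 * b`, where `z` follows the iterated
logarithm. The summand `2 * b` reproduces itself because `2 * logb 2 (1 + 2 * b) ≤ b + 4`; the
condition on `α` absorbs the remaining constants. -/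
lemma clog_step_le {b k α : ℕ} (hα : 2 * α + 8 ≤ 2 ^ α) {z : ℝ} (hz : 1 ≤ z) (hk0 : 0 < k)
    (hk : (k : ℝ) ≤ 2 ^ α * z + 2 * b) :
    ((b + 2 * Nat.clog 2 k : ℕ) : ℝ) ≤ 2 ^ α * max 1 (Real.logb 2 z) + 2 * b := by
  have hb0 : (0 : ℝ) ≤ b := by positivity
  have h1 : (Nat.clog 2 k : ℝ) < Real.logb 2 k + 1 := by
    have := Real.natCeil_logb_natCast 2 k
    rw [← this]
    refine Nat.ceil_lt_add_one (Real.logb_nonneg (by norm_num) ?_)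
    exact_mod_cast hk0
  have hA : (1 : ℝ) ≤ 2 ^ α := one_le_pow₀ (by norm_num)
  have h2 : Real.logb 2 k ≤ α + Real.logb 2 z + Real.logb 2 (1 + 2 * b) := by
    have e : Real.logb 2 (2 ^ α * z * (1 + 2 * b)) =
        α + Real.logb 2 z + Real.logb 2 (1 + 2 * b) := by
      rw [Real.logb_mul (by positivity) (by positivity), Real.logb_mul (by positivity)
        (by positivity), Real.logb_pow, Real.logb_self_eq_one (by norm_num), mul_one]
    rw [← e]
    refine Real.logb_le_logb_of_le (by norm_num) (by exact_mod_cast hk0) (hk.trans ?_)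
    have : 1 ≤ 2 ^ α * z := by nlinarith
    nlinarith
  have h3 : 2 * Real.logb 2 (1 + 2 * b) ≤ b + 4 := by
    have e : 2 * Real.logb 2 (1 + 2 * (b : ℝ)) = Real.logb 2 ((1 + 2 * b) ^ 2) := by
      rw [Real.logb_pow]; norm_num
    have e' : (b + 4 : ℝ) = Real.logb 2 (2 ^ (b + 4)) := by
      rw [Real.logb_pow, Real.logb_self_eq_one (by norm_num)]; push_cast; ring
    rw [e, e']
    refine Real.logb_le_logb_of_le (by norm_num) (by positivity) ?_
    exact_mod_cast one_add_two_mul_sq_le b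
  have h4 : (2 * α + 8 : ℝ) ≤ 2 ^ α := by exact_mod_cast hα
  have h5 := le_max_left 1 (Real.logb 2 z)
  have h6 := le_max_right 1 (Real.logb 2 z)
  generalize max 1 (Real.logb 2 z) = w at *
  push_cast
  nlinarith [Nat.cast_nonneg (α := ℝ) α]

lemma bitLength_le_of_iterate_le {b α : ℕ} (hb : 0 < b) (hα : 2 * α + 8 ≤ 2 ^ α) (t : ℕ) :
    ∀ (k : ℕ) (x : ℝ), 0 < k → (Real.logb 2)^[t] x ≤ 1 → (k : ℝ) ≤ 2 ^ α * max 1 x + 2 * b →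
      bitLength b k t ≤ 2 ^ α + 2 * b := by
  induction t with
  | zero =>
    intro k x _ hx hk
    rw [Function.iterate_zero, id] at hx
    rw [max_eq_left hx, mul_one] at hk
    exact_mod_cast hk
  | succ t ih =>
    intro k x hk0 hx hk
    rw [Function.iterate_succ_apply] at hx
    rw [bitLength_succ']
    refine ih _ _ (by omega) hx ?_
    refine (clog_step_le hα (le_max_left _ _) hk0 hk).trans ?_
    -- The truncation at `1` guards against arguments below `1`, where the real logarithm is
    -- negative or only conventional.
    have : max 1 (Real.logb 2 (max 1 x)) ≤ max 1 (Real.logb 2 x) := by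
      rcases le_total x 1 with h | h
      · rw [max_eq_left h, Real.logb_one]; simp
      · rw [max_eq_right h]
    gcongr

lemma exists_iterate_logb_le_one (x : ℝ) : ∃ i : ℕ, (Real.logb 2)^[i] x ≤ 1 := by
  have key : ∀ m : ℕ, ∀ x : ℝ, x ≤ m + 1 → ∃ i : ℕ, (Real.logb 2)^[i] x ≤ 1 := by
    intro m
    induction m with
    | zero => exact fun x hx => ⟨0, by simpa using hx⟩
    | succ m ih =>
      intro x hx
      rcases le_or_gt x 1 with h | h
      · exact ⟨0, by simpa using h⟩
      · have h2 : Real.logb 2 x ≤ m + 1 := by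
          rw [Real.logb_le_iff_le_rpow (by norm_num) (by linarith)]
          refine hx.trans ?_
          -- For arguments above `1` the logarithm lowers the integer bound by at least one.
          have : m + 1 + 1 ≤ 2 ^ (m + 1) := Nat.lt_two_pow_self
          have h3 : ((m : ℝ) + 1 + 1) ≤ 2 ^ (m + 1) := by exact_mod_cast this
          have h4 : (2 : ℝ) ^ ((m : ℝ) + 1) = 2 ^ (m + 1) := by
            rw [← Real.rpow_natCast]; push_cast; rfl
          rw [h4]
          push_cast
          exact h3
        obtain ⟨i, hi⟩ := ih _ h2
        exact ⟨i + 1, by rwa [Function.iterate_succ_apply]⟩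
  obtain ⟨m, hm⟩ := exists_nat_ge x
  exact key m x (by linarith)

lemma iterate_logStar_le_one (x : ℝ) : (Real.logb 2)^[logStar x] x ≤ 1 :=
  Nat.sInf_mem (s := {i : ℕ | (Real.logb 2)^[i] x ≤ 1}) (exists_iterate_logb_le_one x)

lemma bitLength_logStar_le {b α : ℕ} (hb : 0 < b) (hα : 2 * α + 8 ≤ 2 ^ α) {B n : ℕ}
    (hB : 0 < B) (hBα : 2 * B ≤ 2 ^ α) :
    bitLength b (B * (n + 1)) (logStar n) ≤ 2 ^ α + 2 * b := by
  refine bitLength_le_of_iterate_le hb hα _ _ (n : ℝ) (by positivity)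
    (iterate_logStar_le_one n) ?_
  have h1 : (2 * B : ℝ) ≤ 2 ^ α := by exact_mod_cast hBα
  have h2 : (n + 1 : ℝ) ≤ 2 * max 1 (n : ℝ) := by
    linarith [le_max_left 1 (n : ℝ), le_max_right 1 (n : ℝ)]
  have h3 : 0 ≤ max 1 (n : ℝ) := by positivity
  have h4 : (0 : ℝ) ≤ B := by positivity
  push_cast
  calc (B : ℝ) * (n + 1) ≤ B * (2 * max 1 (n : ℝ)) := by gcongr
    _ = (2 * B) * max 1 (n : ℝ) := by ring
    _ ≤ 2 ^ α * max 1 (n : ℝ) := by gcongr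
    _ ≤ _ := by linarith [Nat.cast_nonneg (α := ℝ) b]

/-- A bit length linear in `n` is wasteful but enough: `bitLength_logStar_le` starts from it and
still needs only `logStar n` reductions. -/
lemma exists_eval_lt_two_pow (p : ℕ[X]) :
    ∃ B : ℕ, 0 < B ∧ ∀ n : ℕ, p.eval n < 2 ^ (B * (n + 1)) := by
  induction p using Polynomial.induction_on' with
  | add p q hp hq =>
    obtain ⟨B, hB0, hB⟩ := hp
    obtain ⟨B', hB0', hB'⟩ := hq
    refine ⟨B + B', by omega, fun n => ?_⟩
    rw [eval_add, add_mul, pow_add]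
    have h1 := hB n
    have h2 := hB' n
    have h3 : 2 ≤ 2 ^ (B * (n + 1)) := Nat.le_self_pow (by positivity) 2
    have h4 : 2 ≤ 2 ^ (B' * (n + 1)) := Nat.le_self_pow (by positivity) 2
    nlinarith
  | monomial d a =>
    refine ⟨a + d + 1, by omega, fun n => ?_⟩
    rw [eval_monomial]
    have h1 : a < 2 ^ a := Nat.lt_two_pow_self
    have h2 : n ^ d ≤ 2 ^ (n * d) := by
      rw [pow_mul]
      exact Nat.pow_le_pow_left Nat.lt_two_pow_self.le d
    calc a * n ^ d ≤ 2 ^ a * 2 ^ (n * d) := Nat.mul_le_mul h1.le h2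
      _ = 2 ^ (a + n * d) := by rw [pow_add]
      _ < 2 ^ ((a + d + 1) * (n + 1)) := Nat.pow_lt_pow_right (by norm_num) (by nlinarith)

end ColourReduction

/-! ### Balls, views, and distance colourings computed from views. -/

section Locality

open scoped Classical

open Finset

universe u

section Balls

variable {V : Type*} {G : SimpleGraph V}

lemma mem_closedBall_self (v : V) (R : ℕ) : v ∈ closedBall G v R := ⟨.nil, by simp⟩

lemma mem_closedBall_comm {v w : V} {R : ℕ} (h : w ∈ closedBall G v R) : v ∈ closedBall G w R := by
  obtain ⟨p, hp⟩ := h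
  exact ⟨p.reverse, by simpa using hp⟩

lemma mem_closedBall_trans {v w x : V} {R R' : ℕ} (h : w ∈ closedBall G v R)
    (h' : x ∈ closedBall G w R') : x ∈ closedBall G v (R + R') := by
  obtain ⟨p, hp⟩ := h
  obtain ⟨p', hp'⟩ := h'
  exact ⟨p.append p', by rw [SimpleGraph.Walk.length_append]; omega⟩

lemma closedBall_mono (v : V) {R R' : ℕ} (h : R ≤ R') : closedBall G v R ⊆ closedBall G v R' :=
  fun _ ⟨p, hp⟩ => ⟨p, hp.trans h⟩

lemma closedBall_zero (v : V) : closedBall G v 0 = {v} := by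
  ext w
  constructor
  · rintro ⟨p, hp⟩
    exact (SimpleGraph.Walk.eq_of_length_eq_zero (Nat.le_zero.1 hp)).symm
  · rintro rfl
    exact mem_closedBall_self _ _

lemma mem_closedBall_succ {v w : V} {R : ℕ} :
    w ∈ closedBall G v (R + 1) ↔
      w ∈ closedBall G v R ∨ ∃ x, G.Adj v x ∧ w ∈ closedBall G x R := by
  constructor
  · rintro ⟨p, hp⟩
    cases p with
    | nil => exact Or.inl (mem_closedBall_self _ _)
    | cons h p =>
      rw [SimpleGraph.Walk.length_cons] at hp
      exact Or.inr ⟨_, h, p, by omega⟩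
  · rintro (h | ⟨x, hx, p, hp⟩)
    · exact closedBall_mono v (Nat.le_succ R) h
    · exact ⟨.cons hx p, by rw [SimpleGraph.Walk.length_cons]; omega⟩

lemma ncard_closedBall_le [Fintype V] [DecidableRel G.Adj] (v : V) (R : ℕ) :
    (closedBall G v R).ncard ≤ (G.maxDegree + 1) ^ R := by
  induction R generalizing v with
  | zero => simp [closedBall_zero]
  | succ R ih =>
    have h1 : closedBall G v (R + 1) =
        ((insert v (G.neighborFinset v)).biUnion fun x => (closedBall G x R).toFinset :
          Finset V) := by
      ext w
      simp [mem_closedBall_succ]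
    rw [h1, Set.ncard_coe_finset]
    have h2 := card_biUnion_le_card_mul (insert v (G.neighborFinset v))
      (fun x => (closedBall G x R).toFinset) ((G.maxDegree + 1) ^ R) fun x _ => by
        rw [← Set.ncard_eq_toFinset_card']
        exact ih x
    refine h2.trans ?_
    rw [pow_succ, mul_comm]
    refine Nat.mul_le_mul_left _ ((card_insert_le _ _).trans ?_)
    rw [SimpleGraph.card_neighborFinset_eq_degree]
    exact Nat.add_le_add_right (G.degree_le_maxDegree v) 1

end Balls

namespace LocalModel

/-- Everything that a vertex can learn in some number of rounds. -/
inductive View : Type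
  | start (x : LocalInput) : View
  | receive (x : LocalInput) (old : View) (received : Fin x.degree → View) : View

/-- The local input of the vertex to which a view belongs. -/
def View.input : View → LocalInput
  | .start x => x
  | .receive x _ _ => x

/-- The view in the preceding round. -/
def View.old : View → View
  | .start x => .start x
  | .receive _ w _ => w

/-- The views received from the neighbours in the last round, in the order of the ports. -/
def View.received : View → List View
  | .start _ => []
  | .receive _ _ m => List.ofFn m

/-- In every round, all vertices send everything they know to all neighbours. -/
def fullInformation (out : (x : LocalInput) → View → Fin x.degree → Bool) : Algorithm where
  State := View
  Msg := View
  init := .start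
  send _ w _ := w
  step x w m := .receive x w m
  output := out

/-- What a vertex knows after `t` rounds of the full information algorithm. -/
def Labeling.view {V : Type*} [Fintype V] {G : SimpleGraph V} [DecidableRel G.Adj]
    (L : Labeling G) : ℕ → V → View
  | 0, v => .start (L.input v)
  | t + 1, v => .receive (L.input v) (L.view t v) fun i : Fin (G.degree v) => L.view t (L.port v i)

lemma stateAfter_fullInformation {V : Type*} [Fintype V] {G : SimpleGraph V} [DecidableRel G.Adj]
    (L : Labeling G) (out : (x : LocalInput) → View → Fin x.degree → Bool) (t : ℕ) (v : V) :
    (fullInformation out).stateAfter L t v = L.view t v := by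
  induction t generalizing v with
  | zero => rfl
  | succ t ih =>
    rw [Algorithm.stateAfter, Labeling.view, ih]
    simp only [ih]
    rfl

/-- A labelled graph with `n` vertices, maximum degree `Δ` and identifiers less than `N`. -/
structure Network (n Δ N : ℕ) : Type (u + 1) where
  /-- the vertices -/
  V : Type u
  [fintype : Fintype V]
  /-- the graph -/
  G : SimpleGraph V
  [decidableAdj : DecidableRel G.Adj]
  /-- identifiers and port numbers -/
  L : Labeling G
  card_eq : Fintype.card V = n
  maxDegree_eq : G.maxDegree = Δ
  id_lt : ∀ v, L.id v < N

attribute [instance] Network.fintype Network.decidableAdj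

variable {n Δ N : ℕ} {X Y Z : Type*}

/-- The values `Φ` can be computed in `t` rounds. -/
def ComputableIn (t : ℕ) (Φ : ∀ I : Network.{u} n Δ N, I.V → X) : Prop :=
  ∃ h : View → X, ∀ (I : Network.{u} n Δ N) (v : I.V), Φ I v = h (I.L.view t v)

variable {t t' : ℕ} {Φ : ∀ I : Network.{u} n Δ N, I.V → X} {Ψ : ∀ I : Network.{u} n Δ N, I.V → Y}

namespace ComputableIn

lemma id : ComputableIn 0 fun (I : Network.{u} n Δ N) v => I.L.id v :=
  ⟨fun w => w.input.id, fun _ _ => rfl⟩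

lemma map (hΦ : ComputableIn t Φ) (k : X → Y) : ComputableIn t fun I v => k (Φ I v) := by
  obtain ⟨h, hh⟩ := hΦ
  exact ⟨fun w => k (h w), fun I v => congrArg k (hh I v)⟩

lemma map₂ (hΦ : ComputableIn t Φ) (hΨ : ComputableIn t Ψ) (k : X → Y → Z) :
    ComputableIn t fun I v => k (Φ I v) (Ψ I v) := by
  obtain ⟨h, hh⟩ := hΦ
  obtain ⟨h', hh'⟩ := hΨ
  exact ⟨fun w => k (h w) (h' w), fun I v => congrArg₂ k (hh I v) (hh' I v)⟩

lemma mono (hΦ : ComputableIn t Φ) (ht : t ≤ t') : ComputableIn t' Φ := by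
  induction t', ht using Nat.le_induction with
  | base => exact hΦ
  | succ t' _ ih =>
    obtain ⟨h, hh⟩ := ih
    exact ⟨fun w => h w.old, fun I v => hh I v⟩

/-- Lists give a result type that does not vary with the degree. -/
lemma ports (hΦ : ComputableIn t Φ) :
    ComputableIn (t + 1) fun I v => List.ofFn fun i => Φ I (I.L.port v i) := by
  obtain ⟨h, hh⟩ := hΦ
  refine ⟨fun w => w.received.map h, fun I v => ?_⟩
  simp only [Labeling.view, View.received, hh]
  exact (List.map_ofFn ..).symm

lemma neighbors (hΦ : ComputableIn t Φ) :
    ComputableIn (t + 1) fun I v => Φ I '' I.G.neighborSet v := by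
  have h := hΦ.ports.map fun l => {x | x ∈ l}
  convert h using 3 with I v
  ext x
  simp only [Set.mem_image, List.mem_ofFn, Set.mem_ofPred_eq]
  constructor
  · rintro ⟨w, hw, rfl⟩
    exact ⟨(I.L.port v).symm ⟨w, hw⟩, by simp⟩
  · rintro ⟨i, rfl⟩
    exact ⟨_, (I.L.port v i).2, rfl⟩

lemma closedBall (hΦ : ComputableIn t Φ) (R : ℕ) :
    ComputableIn (t + R) fun I v => Φ I '' closedBall I.G v R := by
  induction R with
  | zero =>
    simp only [closedBall_zero, Set.image_singleton]
    exact hΦ.map fun x => ({x} : Set X)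
  | succ R ih =>
    have h := (ih.mono (Nat.le_succ _)).map₂ ih.neighbors fun A B => A ∪ ⋃₀ B
    rw [← add_assoc]
    convert h using 3 with I v
    ext x
    simp only [Set.mem_image, mem_closedBall_succ, Set.mem_union, Set.mem_sUnion,
      SimpleGraph.mem_neighborSet]
    grind

end ComputableIn

/-- Vertices at distance at most `R` have distinct colours. -/
def IsDistanceColouring {V : Type*} (G : SimpleGraph V) (R : ℕ) (c : V → ℕ) : Prop :=
  ∀ v w, w ∈ closedBall G v R → w ≠ v → c w ≠ c v

/-- Colour reduction is applied to the graph joining vertices at distance at most `R`. Balls have at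
most `2 ^ D` vertices, and one step costs `R` rounds. -/
lemma exists_computableIn_colouring {R D k : ℕ} (hD : (Δ + 1) ^ R ≤ 2 ^ D) (hk : 0 < k)
    (hN : N ≤ 2 ^ k) (t : ℕ) :
    ∃ c : ∀ I : Network.{u} n Δ N, I.V → ℕ, ComputableIn (R * t) c ∧
      ∀ I, (∀ v, c I v < 2 ^ bitLength (2 * D + 2) k t) ∧ IsDistanceColouring I.G R (c I) := by
  induction t with
  | zero =>
    exact ⟨_, ComputableIn.id, fun I => ⟨fun v => (I.id_lt v).trans_le hN,
      fun v w _ h e => h (I.L.id_injective e)⟩⟩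
  | succ t ih =>
    obtain ⟨c, hc, hI⟩ := ih
    have hl := bitLength_pos (b := 2 * D + 2) (by omega) hk t
    rw [bitLength]
    generalize bitLength (2 * D + 2) k t = l at *
    -- Bertrand's postulate keeps `q` within twice the required size; hence `q * q` has the bit
    -- length `(2 * D + 2) + 2 * Nat.clog 2 l` prescribed by `bitLength`.
    obtain ⟨q, hq, hq1, hq2⟩ := Nat.exists_prime_lt_and_le_two_mul (2 ^ D * l) (by positivity)
    have : Fact q.Prime := ⟨hq⟩
    refine ⟨fun I v => reducedColour q l (c I v) (c I '' closedBall I.G v R),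
      (hc.mono (Nat.le_add_right _ _)).map₂ (hc.closedBall R) _, fun I => ⟨fun v => ?_, ?_⟩⟩
    · refine reducedColour_lt.trans_le ?_
      have h1 : l ≤ 2 ^ Nat.clog 2 l := Nat.le_pow_clog (by norm_num) l
      have h2 : q ≤ 2 ^ (1 + D + Nat.clog 2 l) := by
        rw [pow_add, pow_add, pow_one, mul_assoc]
        exact hq2.trans (Nat.mul_le_mul_left 2 (Nat.mul_le_mul_left _ h1))
      refine (Nat.mul_le_mul h2 h2).trans_eq ?_
      rw [← pow_add]
      congr 1
      ring
    · intro v w hw hne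
      have hlt := (hI I).1
      have key : ∀ x, ∃ S : Finset ℕ, (S : Set ℕ) = c I '' closedBall I.G x R ∧
          (∀ z ∈ S, z < 2 ^ l) ∧ #S ≤ 2 ^ D := by
        intro x
        refine ⟨(Set.toFinite (c I '' closedBall I.G x R)).toFinset, by simp, ?_, ?_⟩
        · intro z hz
          simp only [Set.Finite.mem_toFinset] at hz
          obtain ⟨y, _, rfl⟩ := hz
          exact hlt y
        · rw [← Set.ncard_eq_toFinset_card (c I '' closedBall I.G x R) (Set.toFinite _)]
          refine (Set.ncard_image_le (f := c I) (Set.toFinite (closedBall I.G x R))).trans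
            ((ncard_closedBall_le x R).trans ?_)
          rwa [I.maxDegree_eq]
      obtain ⟨S, hS, hS1, hS2⟩ := key w
      obtain ⟨T, hT, hT1, hT2⟩ := key v
      simp only [← hS, ← hT]
      refine reducedColour_ne (hlt w) (hlt v) hS1 hT1 hS2 hT2 hq1 ?_ ?_
      · rw [← mem_coe, hS]
        exact ⟨v, mem_closedBall_comm hw, rfl⟩
      · exact ((hI I).2 v w hw hne).symm

end LocalModel

end Locality

/-! ### Improvements described by identifiers and recognised from nearby records. -/

section Improvement

open scoped Classical

open Finset

universe u

/-- Unchanged vertices contribute equally to both sides; thus being an improvement can be tested on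
the changes alone. -/
lemma freeCount_lt_iff {V : Type*} [Fintype V] (f g : V → V) :
    freeCount g < freeCount f ↔
      #((diffSet f g).filter fun x => g x = x) < #((diffSet f g).filter fun x => f x = x) := by
  have split : ∀ k : V → V, freeCount k = #((diffSet f g).filter fun x => k x = x) +
      #(univ.filter fun x => x ∉ diffSet f g ∧ k x = x) := by
    intro k
    rw [freeCount, ← card_filter_add_card_filter_not (fun x => x ∈ diffSet f g), filter_filter,
      filter_filter]
    congr 2 <;> ext x <;> simp [and_comm]
  have e : (univ.filter fun x => x ∉ diffSet f g ∧ g x = x) =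
      univ.filter fun x => x ∉ diffSet f g ∧ f x = x := by
    ext x
    simp only [mem_filter, mem_univ, true_and, mem_diffSet, not_not]
    grind
  rw [split f, split g, e]
  omega

namespace LocalModel

section Patches

variable {V : Type*} [Fintype V] {G : SimpleGraph V} [DecidableRel G.Adj]

/-- The changes that turn the matching `f` into `g`, in terms of identifiers. -/
noncomputable def Labeling.changes (L : Labeling G) (f g : V → V) : Finset (ℕ × ℕ) :=
  (diffSet f g).image fun x => (L.id x, L.id (g x))

/-- The identifiers of a vertex, of its partner and of its neighbours. -/
def Labeling.record (L : Labeling G) (f : V → V) (x : V) : ℕ × ℕ × Set ℕ :=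
  (L.id x, L.id (f x), L.id '' G.neighborSet x)

/-- The changes made by the improvements of size `s` that affect the vertex `u`. -/
def Labeling.improvements (L : Labeling G) (f : V → V) (s : ℕ) (u : V) :
    Set (Finset (ℕ × ℕ)) :=
  {q | ∃ g, Improves G f g ∧ #(diffSet f g) = s ∧ u ∈ diffSet f g ∧ q = L.changes f g}

/-- A description of the changes made by improvements that refers only to the records of the
vertices near the vertex with identifier `a₀`. -/
structure IsImprovingChange (Rec : Set (ℕ × ℕ × Set ℕ)) (s a₀ : ℕ) (q : Finset (ℕ × ℕ)) :
    Prop where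
  swap : ∀ a b, (a, b) ∈ q → (b, a) ∈ q
  unique : ∀ a b b', (a, b) ∈ q → (a, b') ∈ q → b = b'
  record : ∀ a b, (a, b) ∈ q → ∃ r ∈ Rec, r.1 = a ∧ r.2.1 ≠ b ∧ (b ≠ a → b ∈ r.2.2) ∧
    ∃ b', (r.2.1, b') ∈ q
  card_eq : #q = s
  lt : #(q.filter fun e => e.2 = e.1) < #(q.filter fun e => ∃ r ∈ Rec, r.1 = e.1 ∧ r.2.1 = e.1)
  mem : ∃ b, (a₀, b) ∈ q

variable {L : Labeling G} {f g : V → V} {s : ℕ} {u : V}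

lemma mem_changes {x y : V} : (L.id x, L.id y) ∈ L.changes f g ↔ x ∈ diffSet f g ∧ g x = y := by
  simp only [Labeling.changes, mem_image, Prod.mk.injEq]
  constructor
  · rintro ⟨z, hz, h1, h2⟩
    obtain rfl := L.id_injective h1
    exact ⟨hz, L.id_injective h2⟩
  · rintro ⟨hx, rfl⟩
    exact ⟨x, hx, rfl, rfl⟩

lemma exists_of_mem_changes {a b : ℕ} (h : (a, b) ∈ L.changes f g) :
    ∃ x ∈ diffSet f g, L.id x = a ∧ L.id (g x) = b := by
  simp only [Labeling.changes, mem_image, Prod.mk.injEq] at h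
  exact h

lemma pair_injective (L : Labeling G) (g : V → V) :
    Function.Injective fun x => (L.id x, L.id (g x)) :=
  fun _ _ h => L.id_injective (Prod.ext_iff.1 h).1

lemma card_changes (L : Labeling G) (f g : V → V) : #(L.changes f g) = #(diffSet f g) :=
  card_image_of_injective _ (pair_injective L g)

lemma card_changes_filter_right (L : Labeling G) (f g : V → V) :
    #((L.changes f g).filter fun e => e.2 = e.1) = #((diffSet f g).filter fun x => g x = x) := by
  rw [Labeling.changes, filter_image, card_image_of_injective _ (pair_injective L g)]
  congr 1
  ext x
  simp [L.id_injective.eq_iff]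

lemma card_changes_filter_left (L : Labeling G) (f g : V → V) {B : Set V}
    (hB : ∀ x ∈ diffSet f g, x ∈ B) :
    #((L.changes f g).filter fun e => ∃ r ∈ L.record f '' B, r.1 = e.1 ∧ r.2.1 = e.1) =
      #((diffSet f g).filter fun x => f x = x) := by
  rw [Labeling.changes, filter_image, card_image_of_injective _ (pair_injective L g)]
  congr 1
  ext x
  simp only [mem_filter, Set.exists_mem_image, Labeling.record]
  refine and_congr_right fun hx => ⟨?_, fun h => ⟨x, hB x hx, rfl, by rw [h]⟩⟩
  rintro ⟨y, _, h1, h2⟩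
  obtain rfl := L.id_injective h1
  exact L.id_injective h2

/-- Stability enters to place all changed vertices inside the ball, so that their records are
available. -/
lemma isImprovingChange_changes (hf : IsMateMap G f) (hg : Improves G f g)
    (hs : StableBelow G f s) (hcard : #(diffSet f g) = s) (hu : u ∈ diffSet f g) :
    IsImprovingChange (L.record f '' closedBall G u s) s (L.id u) (L.changes f g) := by
  have hB : ∀ x ∈ diffSet f g, x ∈ closedBall G u s :=
    fun x hx => hs.diffSet_subset_closedBall hf hg hcard hu hx
  refine ⟨?_, ?_, ?_, ?_, ?_, ?_⟩
  · intro a b h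
    obtain ⟨x, hx, rfl, rfl⟩ := exists_of_mem_changes h
    rw [mem_changes]
    exact ⟨mem_diffSet_of_right hf hg.mate hx, hg.mate.invol x⟩
  · intro a b b' h h'
    obtain ⟨x, hx, rfl, rfl⟩ := exists_of_mem_changes h
    obtain ⟨y, hy, h1, rfl⟩ := exists_of_mem_changes h'
    rw [L.id_injective h1]
  · intro a b h
    obtain ⟨x, hx, rfl, rfl⟩ := exists_of_mem_changes h
    refine ⟨_, ⟨x, hB x hx, rfl⟩, rfl, ?_, ?_, L.id (g (f x)), ?_⟩
    · exact fun h => (mem_diffSet.1 hx) (L.id_injective h)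
    · exact fun h => ⟨g x, hg.mate.adj x fun e => h (by rw [e]), rfl⟩
    · exact mem_changes.2 ⟨mem_diffSet_of_left hf hg.mate hx, rfl⟩
  · rw [card_changes, hcard]
  · rw [card_changes_filter_right, card_changes_filter_left L f g hB, ← freeCount_lt_iff]
    exact hg.lt
  · exact ⟨L.id (g u), mem_changes.2 ⟨hu, rfl⟩⟩

/-- The conditions suffice for any set `B` of recorded vertices: distinct identifiers turn the pairs
into a map `g`, which is then checked to be an improving matching. -/
lemma IsImprovingChange.mem_improvements (hf : IsMateMap G f) {B : Set V}
    {q : Finset (ℕ × ℕ)} (hq : IsImprovingChange (L.record f '' B) s (L.id u) q) :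
    q ∈ L.improvements f s u := by
  have hsource : ∀ a b, (a, b) ∈ q → ∃ x ∈ B, L.id x = a ∧ L.id (f x) ≠ b ∧
      (b ≠ a → b ∈ L.id '' G.neighborSet x) ∧ ∃ b', (L.id (f x), b') ∈ q := by
    intro a b h
    obtain ⟨r, ⟨x, hx, rfl⟩, h1, h2, h3⟩ := hq.record a b h
    exact ⟨x, hx, h1, h2, h3⟩
  have htarget : ∀ a b, (a, b) ∈ q → ∃ x ∈ B, ∃ y, L.id x = a ∧ L.id y = b := by
    intro a b h
    obtain ⟨x, hx, h1, _⟩ := hsource a b h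
    obtain ⟨y, _, h2, _⟩ := hsource b a (hq.swap a b h)
    exact ⟨x, hx, y, h1, h2⟩
  let g : V → V := fun x => if h : ∃ y, (L.id x, L.id y) ∈ q then h.choose else f x
  have hg1 : ∀ x y, (L.id x, L.id y) ∈ q → g x = y := by
    intro x y h
    have h' : ∃ y, (L.id x, L.id y) ∈ q := ⟨y, h⟩
    have e : g x = h'.choose := dif_pos h'
    rw [e]
    exact L.id_injective (hq.unique _ _ _ h'.choose_spec h)
  have hg2 : ∀ x, (¬ ∃ y, (L.id x, L.id y) ∈ q) → g x = f x := fun x h => dif_neg h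
  have hdiff : ∀ x y, (L.id x, L.id y) ∈ q → x ∈ diffSet f g := by
    intro x y h
    rw [mem_diffSet, hg1 x y h]
    rintro rfl
    obtain ⟨z, _, h1, h2, _⟩ := hsource _ _ h
    rw [L.id_injective h1] at h2
    exact h2 rfl
  have hdiff' : ∀ x ∈ diffSet f g, (L.id x, L.id (g x)) ∈ q := by
    intro x hx
    by_cases h : ∃ y, (L.id x, L.id y) ∈ q
    · obtain ⟨y, h⟩ := h
      rwa [hg1 x y h]
    · exact absurd (hg2 x h).symm (mem_diffSet.1 hx)
  have hchanges : q = L.changes f g := by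
    ext ⟨a, b⟩
    constructor
    · intro h
      obtain ⟨x, _, y, rfl, rfl⟩ := htarget a b h
      exact mem_changes.2 ⟨hdiff x y h, hg1 x y h⟩
    · intro h
      obtain ⟨x, hx, rfl, rfl⟩ := exists_of_mem_changes h
      exact hdiff' x hx
  have hB : ∀ x ∈ diffSet f g, x ∈ B := by
    intro x hx
    obtain ⟨z, hz, h1, _⟩ := hsource _ _ (hdiff' x hx)
    rwa [← L.id_injective h1]
  have hmate : IsMateMap G g := by
    constructor
    · intro x
      by_cases hx : x ∈ diffSet f g
      · exact hg1 _ _ (hq.swap _ _ (hdiff' x hx))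
      · have e : g x = f x := by
          rw [mem_diffSet, not_not] at hx
          exact hx.symm
        rw [e]
        by_cases h : ∃ y, (L.id (f x), L.id y) ∈ q
        · obtain ⟨y, h⟩ := h
          -- If the old partner of `x` is changed, the closure condition in `record` makes `x`
          -- changed too; without it `g` need not be an involution.
          obtain ⟨z, _, h1, _, _, b', h2⟩ := hsource _ _ h
          rw [L.id_injective h1, hf.invol] at h2
          obtain ⟨x', _, y', h3, rfl⟩ := htarget _ _ h2
          exact absurd (hdiff x y' h2) hx
        · rw [hg2 _ h, hf.invol]
    · intro x hx
      by_cases h : x ∈ diffSet f g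
      · obtain ⟨z, _, h1, _, h2, _⟩ := hsource _ _ (hdiff' x h)
        obtain ⟨y, hy, h3⟩ := h2 fun e => hx (L.id_injective e)
        rw [L.id_injective h1] at hy
        rwa [← L.id_injective h3]
      · rw [mem_diffSet, not_not] at h
        rw [← h] at hx ⊢
        exact hf.adj x hx
  obtain ⟨b, hb⟩ := hq.mem
  obtain ⟨_, _, y, h1, rfl⟩ := htarget _ _ hb
  refine ⟨g, ⟨hmate, ?_⟩, ?_, hdiff u y hb, hchanges⟩
  · rw [freeCount_lt_iff, ← card_changes_filter_right L, ← card_changes_filter_left L f g hB,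
      ← hchanges]
    exact hq.lt
  · rw [← card_changes L, ← hchanges, hq.card_eq]

lemma improvements_eq (hf : IsMateMap G f) (hs : StableBelow G f s) :
    L.improvements f s u =
      {q | IsImprovingChange (L.record f '' closedBall G u s) s (L.id u) q} := by
  ext q
  constructor
  · rintro ⟨g, hg, hcard, hu, rfl⟩
    exact isImprovingChange_changes hf hg hs hcard hu
  · exact fun hq => hq.mem_improvements hf

end Patches

end LocalModel

end Improvement

/-! ### Running through colours and sizes, with the round count. -/

section Main

open scoped Classical

open Finset

universe u

namespace LocalModel

/-- An element of `A`, if there is one. -/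
noncomputable def pick (A : Set (Finset (ℕ × ℕ))) : Finset (ℕ × ℕ) :=
  if h : A.Nonempty then h.choose else ∅

/-- The partner of the vertex with identifier `a` after the changes in `A`, where `b₀` is its
partner before. -/
noncomputable def newPartner (A : Set (Finset (ℕ × ℕ))) (a b₀ : ℕ) : ℕ :=
  if h : ∃ b, ∃ q ∈ A, (a, b) ∈ q then h.choose else b₀

section Augment

variable {V : Type*} [Fintype V] {G : SimpleGraph V} [DecidableRel G.Adj]

/-- The improvement selected by the vertex `u` if it has the colour `j`. -/
noncomputable def Labeling.selected (L : Labeling G) (f : V → V) (c : V → ℕ) (s j : ℕ) (u : V) :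
    Finset (ℕ × ℕ) :=
  if c u = j then pick (L.improvements f s u) else ∅

/-- The matching after the changes selected by the vertices of colour `j`. -/
noncomputable def Labeling.augment (L : Labeling G) (f : V → V) (c : V → ℕ) (s j : ℕ) (x : V) :
    V :=
  if h : ∃ y u, (L.id x, L.id y) ∈ L.selected f c s j u then h.choose else f x

variable {L : Labeling G} {f : V → V} {c : V → ℕ} {s j : ℕ}

lemma Labeling.exists_selected_eq (L : Labeling G) (f : V → V) (c : V → ℕ) (s j : ℕ) :
    ∃ k : V → V → V, ∀ u, c u = j → Improvable G f s u →
      Improves G f (k u) ∧ #(diffSet f (k u)) = s ∧ u ∈ diffSet f (k u) ∧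
        L.selected f c s j u = L.changes f (k u) := by
  have : ∀ u, ∃ g : V → V, c u = j → Improvable G f s u →
      Improves G f g ∧ #(diffSet f g) = s ∧ u ∈ diffSet f g ∧
        L.selected f c s j u = L.changes f g := by
    intro u
    by_cases h : c u = j ∧ Improvable G f s u
    · obtain ⟨h1, g₀, h2, h3, h4⟩ := h
      have hne : (L.improvements f s u).Nonempty := ⟨_, g₀, h2, h3, h4, rfl⟩
      obtain ⟨g, h5, h6, h7, h8⟩ := hne.choose_spec
      refine ⟨g, fun _ _ => ⟨h5, h6, h7, ?_⟩⟩
      rw [Labeling.selected, if_pos h1, pick, dif_pos hne, h8]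
    · exact ⟨f, fun h1 h2 => absurd ⟨h1, h2⟩ h⟩
  exact ⟨fun u => (this u).choose, fun u => (this u).choose_spec⟩

lemma improvable_of_mem_selected {u : V} {e : ℕ × ℕ} (h : e ∈ L.selected f c s j u) :
    c u = j ∧ Improvable G f s u := by
  rw [Labeling.selected] at h
  split_ifs at h with hc
  · rw [pick] at h
    split_ifs at h with hne
    · obtain ⟨q, g, h1, h2, h3, _⟩ := hne
      exact ⟨hc, g, h1, h2, h3⟩
    · simp at h
  · simp at h

/-- Two selected improvements meeting at a vertex would come from vertices of equal colour at
distance at most `2 * s`. An improvement that changes `x` is chosen within distance `s` of `x`, so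
the new partner can be read off that ball. -/
lemma exists_isMerge_augment (hf : IsMateMap G f) (hs : StableBelow G f s)
    (hc : IsDistanceColouring G (2 * s) c) (L : Labeling G) (j : ℕ) :
    ∃ k : V → V → V,
      IsMerge G f s (univ.filter fun u => c u = j ∧ Improvable G f s u) k (L.augment f c s j) ∧
      ∀ x, L.id (L.augment f c s j x) =
        newPartner (L.selected f c s j '' closedBall G x s) (L.id x) (L.id (f x)) := by
  obtain ⟨k, hk⟩ := L.exists_selected_eq f c s j
  have hball : ∀ u, c u = j → Improvable G f s u → ∀ x ∈ diffSet f (k u),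
      x ∈ closedBall G u s := by
    intro u h1 h2 x hx
    obtain ⟨h3, h4, h5, _⟩ := hk u h1 h2
    exact hs.diffSet_subset_closedBall hf h3 h4 h5 hx
  have hdisj : ∀ u u', c u = j → Improvable G f s u → c u' = j → Improvable G f s u' →
      ∀ x, x ∈ diffSet f (k u) → x ∈ diffSet f (k u') → u = u' := by
    intro u u' h1 h2 h1' h2' x hx hx'
    by_contra hne
    have h3 := mem_closedBall_trans (hball u h1 h2 x hx)
      (mem_closedBall_comm (hball u' h1' h2' x hx'))
    rw [← two_mul] at h3
    exact hc u u' h3 (Ne.symm hne) (h1'.trans h1.symm)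
  have hsel : ∀ u x b, (L.id x, b) ∈ L.selected f c s j u ↔
      (c u = j ∧ Improvable G f s u) ∧ x ∈ diffSet f (k u) ∧ b = L.id (k u x) := by
    intro u x b
    constructor
    · intro h
      obtain ⟨h1, h2⟩ := improvable_of_mem_selected h
      rw [(hk u h1 h2).2.2.2] at h
      obtain ⟨y, hy, h3, rfl⟩ := exists_of_mem_changes h
      obtain rfl := L.id_injective h3
      exact ⟨⟨h1, h2⟩, hy, rfl⟩
    · rintro ⟨⟨h1, h2⟩, h3, rfl⟩
      rw [(hk u h1 h2).2.2.2, mem_changes]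
      exact ⟨h3, rfl⟩
  have hmem : ∀ u, (c u = j ∧ Improvable G f s u) → ∀ x ∈ diffSet f (k u),
      L.augment f c s j x = k u x := by
    intro u hu x hx
    have h : ∃ y u, (L.id x, L.id y) ∈ L.selected f c s j u :=
      ⟨k u x, u, (hsel u x _).2 ⟨hu, hx, rfl⟩⟩
    obtain ⟨u', h'⟩ := h.choose_spec
    obtain ⟨h1, h2, h3⟩ := (hsel u' x _).1 h'
    obtain rfl := hdisj u u' hu.1 hu.2 h1.1 h1.2 x hx h2
    rw [Labeling.augment, dif_pos h]
    exact L.id_injective h3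
  have hnot : ∀ x, (∀ u, (c u = j ∧ Improvable G f s u) → x ∉ diffSet f (k u)) →
      L.augment f c s j x = f x := by
    intro x hx
    rw [Labeling.augment, dif_neg]
    rintro ⟨y, u, h⟩
    obtain ⟨h1, h2, _⟩ := (hsel u x _).1 h
    exact hx u h1 h2
  refine ⟨k, ⟨?_, ?_, ?_, ?_, ?_, ?_⟩, fun x => ?_⟩
  · intro u hu
    simp only [mem_filter, mem_univ, true_and] at hu
    exact (hk u hu.1 hu.2).1
  · intro u hu
    simp only [mem_filter, mem_univ, true_and] at hu
    exact (hk u hu.1 hu.2).2.1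
  · intro u hu
    simp only [mem_filter, mem_univ, true_and] at hu
    exact (hk u hu.1 hu.2).2.2.1
  · intro u hu u' hu' hne
    simp only [mem_filter, mem_univ, true_and] at hu hu'
    exact disjoint_left.2 fun x hx hx' => hne (hdisj u u' hu.1 hu.2 hu'.1 hu'.2 x hx hx')
  · intro u hu
    simp only [mem_filter, mem_univ, true_and] at hu
    exact hmem u hu
  · intro x hx
    simp only [mem_filter, mem_univ, true_and] at hx
    exact hnot x hx
  · by_cases h : ∃ u, (c u = j ∧ Improvable G f s u) ∧ x ∈ diffSet f (k u)
    · obtain ⟨u, hu, hx⟩ := h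
      have h : ∃ b, ∃ q ∈ L.selected f c s j '' closedBall G x s, (L.id x, b) ∈ q :=
        ⟨L.id (k u x), _, ⟨u, mem_closedBall_comm (hball u hu.1 hu.2 x hx), rfl⟩,
          (hsel u x _).2 ⟨hu, hx, rfl⟩⟩
      obtain ⟨_, ⟨u', _, rfl⟩, h'⟩ := h.choose_spec
      obtain ⟨h1, h2, h3⟩ := (hsel u' x _).1 h'
      obtain rfl := hdisj u u' hu.1 hu.2 h1.1 h1.2 x hx h2
      rw [hmem u hu x hx, newPartner, dif_pos h, h3]
    · push Not at h
      rw [hnot x h, newPartner, dif_neg]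
      rintro ⟨b, _, ⟨u, _, rfl⟩, h'⟩
      obtain ⟨h1, h2, _⟩ := (hsel u x _).1 h'
      exact h u h1 h2

end Augment

variable {n Δ N : ℕ} {t : ℕ} {f : ∀ I : Network.{u} n Δ N, I.V → I.V}
  {c : ∀ I : Network.{u} n Δ N, I.V → ℕ} {s : ℕ}

/-- One round collects neighbouring identifiers for the records, `s` rounds collect records, and `s`
more collect selections. The arbitrary choice in `pick` is harmless because it depends only on a set
of identifier pairs. -/
lemma ComputableIn.augment (hf : ∀ I, IsMateMap I.G (f I)) (hs : ∀ I, StableBelow I.G (f I) s)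
    (hcol : ∀ I : Network.{u} n Δ N, IsDistanceColouring I.G (2 * s) (c I))
    (hft : ComputableIn t fun I v => I.L.id (f I v)) (hct : ComputableIn t c) (j : ℕ) :
    ComputableIn (t + (2 * s + 1)) fun I v => I.L.id (I.L.augment (f I) (c I) s j v) := by
  have hid : ComputableIn t fun (I : Network.{u} n Δ N) v => I.L.id v :=
    ComputableIn.id.mono (Nat.zero_le t)
  have hrec : ComputableIn (t + 1) fun (I : Network.{u} n Δ N) v => I.L.record (f I) v :=
    (hid.mono (Nat.le_succ t)).map₂ ((hft.mono (Nat.le_succ t)).map₂ hid.neighbors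
      fun b A => (b, A)) fun a e => (a, e)
  have himp : ComputableIn (t + 1 + s) fun (I : Network.{u} n Δ N) v =>
      I.L.improvements (f I) s v := by
    have h := (hid.mono (show t ≤ t + 1 + s by omega)).map₂ (hrec.closedBall s) fun a Rec =>
      {q | IsImprovingChange Rec s a q}
    convert h using 3 with I v
    exact improvements_eq (hf I) (hs I)
  have hsel : ComputableIn (t + 1 + s) fun (I : Network.{u} n Δ N) v =>
      I.L.selected (f I) (c I) s j v :=
    (hct.mono (show t ≤ t + 1 + s by omega)).map₂ himp fun a A => if a = j then pick A else ∅
  have hnew := (hid.mono (show t ≤ t + 1 + s + s by omega)).map₂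
    ((hft.mono (show t ≤ t + 1 + s + s by omega)).map₂ (hsel.closedBall s)
      fun b A => (b, A)) fun a e => newPartner e.2 a e.1
  rw [show t + (2 * s + 1) = t + 1 + s + s by ring]
  convert hnew using 3 with I v
  obtain ⟨k, -, hk⟩ := exists_isMerge_augment (hf I) (hs I) (hcol I) I.L j
  exact hk v

lemma exists_computableIn_stableBelow_succ {K : ℕ} (hf : ∀ I, IsMateMap I.G (f I))
    (hs : ∀ I, StableBelow I.G (f I) s)
    (hcol : ∀ I : Network.{u} n Δ N, IsDistanceColouring I.G (2 * s) (c I))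
    (hK : ∀ I v, c I v < K)
    (hft : ComputableIn t fun I v => I.L.id (f I v)) (hct : ComputableIn t c) :
    ∃ F : ∀ I : Network.{u} n Δ N, I.V → I.V,
      (ComputableIn (t + K * (2 * s + 1)) fun I v => I.L.id (F I v)) ∧
      ∀ I, IsMateMap I.G (F I) ∧ StableBelow I.G (F I) (s + 1) := by
  -- After the colours below `j` have acted, only vertices of colour at least `j` are still
  -- improvable. With all `K` colours done, none is.
  have key : ∀ j : ℕ, ∃ F : ∀ I : Network.{u} n Δ N, I.V → I.V,
      (ComputableIn (t + j * (2 * s + 1)) fun I v => I.L.id (F I v)) ∧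
      (∀ I, IsMateMap I.G (F I)) ∧ (∀ I, StableBelow I.G (F I) s) ∧
      ∀ I u, Improvable I.G (F I) s u → j ≤ c I u := by
    intro j
    induction j with
    | zero => exact ⟨f, by simpa using hft, hf, hs, fun _ _ _ => Nat.zero_le _⟩
    | succ j ih =>
      obtain ⟨F, hFt, hF, hFs, hFc⟩ := ih
      refine ⟨fun I => I.L.augment (F I) (c I) s j, ?_, fun I => ?_, fun I => ?_, fun I u hu => ?_⟩
      · have h := hFt.augment hF hFs hcol (hct.mono (Nat.le_add_right _ _)) j
        convert h using 1
        ring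
      all_goals obtain ⟨k, hk, -⟩ := exists_isMerge_augment (hF I) (hFs I) (hcol I) I.L j
      · exact hk.isMateMap (hF I)
      · exact hk.stableBelow (hF I) (hFs I)
      · have h1 := hk.improvable (hF I) (hFs I) hu
        have h2 := hFc I u h1
        refine lt_of_le_of_ne h2 fun e => ?_
        refine hk.not_improvable (hF I) (hFs I) ?_ hu
        simp only [mem_filter, mem_univ, true_and]
        exact ⟨e.symm, h1⟩
  obtain ⟨F, hFt, hF, hFs, hFc⟩ := key K
  refine ⟨F, hFt, fun I => ⟨hF I, fun g hg => ?_⟩⟩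
  refine lt_of_le_of_ne (hFs I g hg) fun e => ?_
  have hne : (diffSet (F I) g).Nonempty := by
    by_contra h
    rw [not_nonempty_iff_eq_empty] at h
    have h2 := (freeCount_lt_iff (F I) g).1 hg.lt
    simp [h] at h2
  obtain ⟨u, hu⟩ := hne
  exact (hK I u).not_ge (hFc I u ⟨g, hg, e.symm, hu⟩)

lemma exists_computableIn_stableBelow {K S : ℕ}
    (hcol : ∀ I : Network.{u} n Δ N, IsDistanceColouring I.G (2 * S) (c I))
    (hK : ∀ I v, c I v < K) (hct : ComputableIn t c) :
    ∃ F : ∀ I : Network.{u} n Δ N, I.V → I.V,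
      (ComputableIn (t + S * (K * (2 * S + 1))) fun I v => I.L.id (F I v)) ∧
      ∀ I, IsMateMap I.G (F I) ∧ StableBelow I.G (F I) S := by
  have key : ∀ s ≤ S, ∃ F : ∀ I : Network.{u} n Δ N, I.V → I.V,
      (ComputableIn (t + s * (K * (2 * S + 1))) fun I v => I.L.id (F I v)) ∧
      ∀ I, IsMateMap I.G (F I) ∧ StableBelow I.G (F I) s := by
    intro s
    induction s with
    -- The empty matching is stable below `0` for trivial reasons.
    | zero =>
      intro _
      exact ⟨fun _ v => v, ComputableIn.id.mono (Nat.zero_le _),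
        fun I => ⟨⟨fun _ => rfl, fun _ h => absurd rfl h⟩, fun _ _ => Nat.zero_le _⟩⟩
    | succ s ih =>
      intro hsS
      obtain ⟨F, hFt, hF⟩ := ih (Nat.le_of_succ_le hsS)
      obtain ⟨F', hFt', hF'⟩ := exists_computableIn_stableBelow_succ (fun I => (hF I).1)
        (fun I => (hF I).2)
        (fun I v w hw => hcol I v w (closedBall_mono v (by omega) hw)) hK hFt
        (hct.mono (Nat.le_add_right _ _))
      refine ⟨F', hFt'.mono ?_, hF'⟩
      have : K * (2 * s + 1) ≤ K * (2 * S + 1) := Nat.mul_le_mul_left K (by omega)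
      rw [add_one_mul, ← add_assoc]
      exact Nat.add_le_add_left this _
  exact key S le_rfl

/-- The number of rounds of the algorithm, which yields a matching without improvements of size
less than `S`; the constant `α` depends on the bound on the identifiers. -/
noncomputable def rounds (S α n Δ : ℕ) : ℕ :=
  2 * S * logStar n +
    (S * (2 ^ (2 ^ α + 2 * (2 * (4 * S * Nat.clog 2 Δ) + 2)) * (2 * S + 1)) + 1)

lemma exists_computableIn_matching {S B α : ℕ} (hα : 2 * α + 8 ≤ 2 ^ α) (hB : 0 < B)
    (hBα : 2 * B ≤ 2 ^ α) (hΔ : 2 ≤ Δ) :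
    ∃ (F : ∀ I : Network.{u} n Δ (2 ^ (B * (n + 1))), I.V → I.V) (h : View → List Bool),
      ∀ I, IsMateMap I.G (F I) ∧ StableBelow I.G (F I) S ∧
        ∀ v, h (I.L.view (rounds S α n Δ) v) =
          List.ofFn fun i => decide (F I v = I.L.port v i) := by
  have hD : (Δ + 1) ^ (2 * S) ≤ 2 ^ (4 * S * Nat.clog 2 Δ) := by
    have h1 : Δ ≤ 2 ^ Nat.clog 2 Δ := Nat.le_pow_clog (by norm_num) Δ
    have h2 : Δ + 1 ≤ (2 ^ Nat.clog 2 Δ) ^ 2 := by nlinarith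
    refine (Nat.pow_le_pow_left h2 _).trans_eq ?_
    rw [← pow_mul, ← pow_mul]
    congr 1
    ring
  obtain ⟨c, hct, hc⟩ := exists_computableIn_colouring.{u} (n := n) (N := 2 ^ (B * (n + 1))) hD
    (show 0 < B * (n + 1) by positivity) le_rfl (logStar n)
  obtain ⟨F, hFt, hF⟩ := exists_computableIn_stableBelow (S := S)
    (K := 2 ^ (2 ^ α + 2 * (2 * (4 * S * Nat.clog 2 Δ) + 2))) (fun I => (hc I).2)
    (fun I v => ((hc I).1 v).trans_le (Nat.pow_le_pow_right (by norm_num)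
      (bitLength_logStar_le (by omega) hα hB hBα))) hct
  have hid := (ComputableIn.id (n := n) (Δ := Δ) (N := 2 ^ (B * (n + 1)))).mono (Nat.zero_le
    (2 * S * logStar n + S * (2 ^ (2 ^ α + 2 * (2 * (4 * S * Nat.clog 2 Δ) + 2)) * (2 * S + 1))))
  -- The extra round in `rounds` tells a vertex which port leads to the identifier of its partner.
  obtain ⟨h, hh⟩ := (hFt.mono (Nat.le_succ _)).map₂ hid.ports
    fun b l => l.map fun a => decide (b = a)
  refine ⟨F, h, fun I => ⟨(hF I).1, (hF I).2, fun v => ?_⟩⟩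
  rw [rounds, ← add_assoc]
  refine (hh I v).symm.trans ?_
  refine (List.map_ofFn ..).trans ?_
  congr 1
  funext i
  simp [I.L.id_injective.eq_iff]

lemma rounds_le {S α n Δ : ℕ} (hΔ : 2 ≤ Δ) :
    rounds S α n Δ ≤ 2 * S * logStar n + Δ ^ (2 ^ α + 34 * S + 11) := by
  rw [rounds]
  refine Nat.add_le_add_left ?_ _
  have h1 : 2 ^ Nat.clog 2 Δ ≤ Δ ^ 2 := by
    have h := Nat.pow_pred_clog_lt_self (b := 2) (by norm_num) (show 1 < Δ by omega)
    have h0 : 0 < Nat.clog 2 Δ := Nat.clog_pos (by norm_num) hΔ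
    have e : 2 ^ Nat.clog 2 Δ = 2 * 2 ^ (Nat.clog 2 Δ).pred := by
      rw [← pow_succ', ← Nat.succ_eq_add_one, Nat.succ_pred_eq_of_pos h0]
    rw [e]
    nlinarith
  have h2 : 2 ^ (2 ^ α + 2 * (2 * (4 * S * Nat.clog 2 Δ) + 2)) ≤ Δ ^ (2 ^ α + 4 + 32 * S) := by
    have e : 2 ^ α + 2 * (2 * (4 * S * Nat.clog 2 Δ) + 2) =
        (2 ^ α + 4) + Nat.clog 2 Δ * (16 * S) := by ring
    rw [e, pow_add, pow_mul, pow_add Δ, show 32 * S = 2 * (16 * S) by ring, pow_mul Δ 2]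
    exact Nat.mul_le_mul (Nat.pow_le_pow_left hΔ _) (Nat.pow_le_pow_left h1 _)
  have h3 : S * (2 * S + 1) + 1 ≤ Δ ^ (2 * S + 2) := by
    have h4 : S < 2 ^ S := Nat.lt_two_pow_self
    have h5 : S * (2 * S + 1) + 1 ≤ 2 ^ (2 * S + 2) := by
      rw [pow_add, two_mul, pow_add]
      nlinarith
    exact h5.trans (Nat.pow_le_pow_left hΔ _)
  generalize 2 ^ (2 ^ α + 2 * (2 * (4 * S * Nat.clog 2 Δ) + 2)) = K at *
  have h6 : 1 ≤ Δ ^ (2 ^ α + 4 + 32 * S) := Nat.one_le_pow _ _ (by omega)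
  calc S * (K * (2 * S + 1)) + 1 = K * (S * (2 * S + 1)) + 1 := by ring
    _ ≤ Δ ^ (2 ^ α + 4 + 32 * S) * (S * (2 * S + 1)) + Δ ^ (2 ^ α + 4 + 32 * S) :=
      Nat.add_le_add (Nat.mul_le_mul_right _ h2) h6
    _ = Δ ^ (2 ^ α + 4 + 32 * S) * (S * (2 * S + 1) + 1) := by ring
    _ ≤ Δ ^ (2 ^ α + 4 + 32 * S) * Δ ^ (2 * S + 2) := Nat.mul_le_mul_left _ h3
    _ = Δ ^ (2 ^ α + 34 * S + 6) := by rw [← pow_add]; congr 1; ring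
    _ ≤ _ := Nat.pow_le_pow_right (by omega) (by omega)

/-- The constant is `181 = 34 * 5 + 11`, from the exponent in `rounds_le` and `ε * S ≤ 5`. -/
lemma rounds_le_rpow {S α n Δ : ℕ} (hΔ : 2 ≤ Δ) {ε : ℝ} (hε : 0 < ε) (hε1 : ε < 1)
    (hS : ε * S ≤ 5) :
    (rounds S α n Δ : ℝ) ≤ (Δ : ℝ) ^ ((2 ^ α + 181 : ℝ) / ε) +
      (2 ^ α + 181) / ε ^ 2 * logStar n := by
  have h1 : (rounds S α n Δ : ℝ) ≤ 2 * S * logStar n + (Δ : ℝ) ^ (2 ^ α + 34 * S + 11) := by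
    exact_mod_cast rounds_le (α := α) (n := n) hΔ
  have hA : (0 : ℝ) < 2 ^ α := by positivity
  have h2 : (Δ : ℝ) ^ (2 ^ α + 34 * S + 11) ≤ (Δ : ℝ) ^ ((2 ^ α + 181 : ℝ) / ε) := by
    rw [← Real.rpow_natCast]
    refine Real.rpow_le_rpow_of_exponent_le (by exact_mod_cast (by omega : 1 ≤ Δ)) ?_
    rw [le_div_iff₀ hε]
    push_cast
    nlinarith
  have h3 : (2 * S : ℝ) ≤ (2 ^ α + 181) / ε ^ 2 := by
    rw [le_div_iff₀ (by positivity)]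
    nlinarith
  have h4 := mul_le_mul_of_nonneg_right h3 (Nat.cast_nonneg (α := ℝ) (logStar n))
  linarith

end LocalModel

end Main

/-! ### One algorithm for all graphs. -/

section Assembly

universe u

namespace LocalModel

lemma exists_algorithm_computesIn {S B α : ℕ} (hα : 2 * α + 8 ≤ 2 ^ α) (hB : 0 < B)
    (hBα : 2 * B ≤ 2 ^ α) {ε : ℝ} (hε : 0 < ε) (hS : 4 ≤ ε * S) :
    ∃ A : Algorithm, ∀ (V : Type u) [Fintype V] (G : SimpleGraph V) [DecidableRel G.Adj]
      (L : Labeling G), (∀ v, L.id v < 2 ^ (B * (Fintype.card V + 1))) →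
        ∃ M : G.Subgraph,
          A.ComputesIn L (if G.maxDegree ≤ 1 then 0 else
            rounds S α (Fintype.card V) G.maxDegree) M ∧ IsApproxMaximumMatching ε M := by
  -- A decoder is fixed for every pair `(n, Δ)`; a single algorithm can use them all since both
  -- numbers belong to the local input.
  have key : ∀ n Δ : ℕ, ∃ h : View → List Bool, 2 ≤ Δ →
      ∃ F : ∀ I : Network.{u} n Δ (2 ^ (B * (n + 1))), I.V → I.V, ∀ I,
        IsMateMap I.G (F I) ∧ StableBelow I.G (F I) S ∧
          ∀ v, h (I.L.view (rounds S α n Δ) v) =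
            List.ofFn fun i => @decide (F I v = I.L.port v i) (Classical.propDecidable _) := by
    intro n Δ
    by_cases hΔ : 2 ≤ Δ
    · obtain ⟨F, h, hF⟩ := exists_computableIn_matching.{u} (n := n) (S := S) hα hB hBα hΔ
      exact ⟨h, fun _ => ⟨F, hF⟩⟩
    · exact ⟨fun _ => [], fun h => absurd h hΔ⟩
  choose h hh using key
  refine ⟨fullInformation fun x w i => if x.maxDegree ≤ 1 then true else
    (h x.numVertices x.maxDegree w).getD i false, fun V _ G _ L hL => ?_⟩
  by_cases hG : G.maxDegree ≤ 1
  · obtain ⟨M, hM, hM'⟩ := isApproxMaximumMatching_of_maxDegree_le_one hG hε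
    refine ⟨M, fun v i => ?_, hM'⟩
    rw [hM]
    have h1 : (L.input v).maxDegree ≤ 1 := hG
    simp only [Algorithm.result, fullInformation, h1, if_true, true_iff]
    exact (L.port v i).2
  · obtain ⟨F, hF⟩ := hh (Fintype.card V) G.maxDegree (by omega)
    obtain ⟨hmate, hstable, hview⟩ := hF ⟨V, G, L, rfl, rfl, hL⟩
    refine ⟨hmate.toSubgraph, fun v i => ?_, hmate.isApproxMaximumMatching hstable hS hε⟩
    have h1 : ¬ (L.input v).maxDegree ≤ 1 := hG
    rw [if_neg hG, Algorithm.result, stateAfter_fullInformation]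
    simp only [fullInformation, h1, if_false]
    have h2 := congrArg (fun l : List Bool => l.getD i false) (hview v)
    refine (Bool.eq_iff_iff.1 h2).trans ?_
    have hi : (i : ℕ) < G.degree v := i.2
    simp only [List.getD_eq_getElem?_getD, List.getElem?_ofFn, hi, dif_pos, Option.getD_some,
      decide_eq_true_eq]
    exact ⟨fun e => ⟨e, (G.ne_of_adj (L.port v i).2)⟩, fun e => e.1⟩

theorem exists_algorithm_isApproxMaximumMatching (p : Polynomial ℕ) :
    ∃ C : ℝ, 0 < C ∧
      ∀ ε : ℝ, 0 < ε → ε < 1 →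
        ∃ (A : Algorithm) (r : ℕ → ℕ → ℕ),
          (∀ n Δ : ℕ,
            (r n Δ : ℝ) ≤ (Δ : ℝ) ^ (C / ε) + C / ε ^ 2 * (logStar (n : ℝ) : ℝ)) ∧
          ∀ (V : Type u) [Fintype V] (G : SimpleGraph V) [DecidableRel G.Adj] (L : Labeling G),
            (∀ v : V, L.id v ≤ p.eval (Fintype.card V)) →
              ∃ M : G.Subgraph,
                A.ComputesIn L (r (Fintype.card V) G.maxDegree) M ∧
                  IsApproxMaximumMatching ε M := by
  obtain ⟨B, hB, hp⟩ := exists_eval_lt_two_pow p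
  have hα : 2 * (2 * B + 5) + 8 ≤ 2 ^ (2 * B + 5) := by
    have : 2 * B < 2 ^ (2 * B) := Nat.lt_two_pow_self
    rw [pow_add]
    omega
  refine ⟨2 ^ (2 * B + 5) + 181, by positivity, fun ε hε hε1 => ?_⟩
  -- The size `⌈4 / ε⌉₊` is large enough for the ratio, and rounding up costs at most `ε < 1` after
  -- multiplication by `ε`.
  have hS : 4 ≤ ε * ⌈4 / ε⌉₊ := by
    have := Nat.le_ceil (4 / ε)
    rwa [div_le_iff₀' hε] at this
  have hS' : ε * ⌈4 / ε⌉₊ ≤ 5 := by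
    have h1 := (Nat.ceil_lt_add_one (show 0 ≤ 4 / ε by positivity)).le
    have h2 := mul_le_mul_of_nonneg_left h1 hε.le
    rw [mul_add, mul_div_cancel₀ _ hε.ne'] at h2
    linarith
  obtain ⟨A, hA⟩ := exists_algorithm_computesIn.{u} hα hB (by omega) hε hS
  refine ⟨A, fun n Δ => if Δ ≤ 1 then 0 else rounds ⌈4 / ε⌉₊ (2 * B + 5) n Δ,
    fun n Δ => ?_, fun V _ G _ L hL => hA V G L fun v => (hL v).trans_lt (hp _)⟩
  beta_reduce
  split_ifs with hΔ
  · rw [Nat.cast_zero]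
    positivity
  · exact rounds_le_rpow (by omega) hε hε1 hS'

end LocalModel

end Assembly

theorem mainTheorem1 (p : Polynomial ℕ) :
    ∃ C : ℝ, 0 < C ∧
      ∀ ε : ℝ, 0 < ε → ε < 1 →
        ∃ (A : LocalModel.Algorithm) (r : ℕ → ℕ → ℕ),
          (∀ n Δ : ℕ,
            (r n Δ : ℝ) ≤ (Δ : ℝ) ^ (C / ε) + C / ε ^ 2 * (logStar (n : ℝ) : ℝ)) ∧
          ∀ (V : Type*) [Fintype V] (G : SimpleGraph V) [DecidableRel G.Adj]
            (L : LocalModel.Labeling G),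
            (∀ v : V, L.id v ≤ p.eval (Fintype.card V)) →
              ∃ M : G.Subgraph,
                A.ComputesIn L (r (Fintype.card V) G.maxDegree) M ∧
                  IsApproxMaximumMatching ε M := by
  exact LocalModel.exists_algorithm_isApproxMaximumMatching p
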